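/- Let $n_1,k_1,n_2,k_2$ be integers with $1\le k_1\le n_1$ and $1\le k_2\le n_2$, and let $\mu_1,\mu_2>0$. Let $T_{i,j}$ ($1\le i\le n_2$, $1\le j\le n_1$) be exponential random variables with rate $\mu_1$ and $T^{(c)}_i$ ($1\le i\le n_2$) exponential random variables with rate $\mu_2$, all of them mutually independent. Let $T_{(m)}$ denote the $m$-th smallest of the $n_1n_2$ variables $T_{i,j}$, and put $$\mathcal L:=\mathbb E\Big[\,k_2^{\text{th}}\!\min_{1\le i\le n_2}\big(T^{(c)}_i+T_{(ik_1)}\big)\Big],$$ where $k^{\text{th}}\min$ denotes the $k$-th smallest value of a finite family, counted with multiplicity. Let $\mathbb C$ be the (right-continuous) continuous-time Markov chain on the state space $\{0,1,\dots,n_2k_1\}\times\{0,1,\dots,k_2\}$, started at $(0,0)$, with the following transition rates (all others being zero): - from $(u,v)$ to $(u+1,v)$ at rate $(n_1n_2-u)\mu_1$, if $vk_1\le u<n_2k_1$; - from $(u,v)$ to $(u,v+1)$ at rate $(\lfloor u/k_1\rfloor-v)\mu_2$, if $0\le v<\min\{\lfloor u/k_1\rfloor,k_2\}$. Then $\mathcal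 L$ is finite, and the expected hitting time of $\mathbb C$ from state $(0,0)$ to the set of states $\{(u,k_2): k_2k_1\le u\le n_2k_1\}$ is equal to $\mathcal L$. -/

import Mathlib

open MeasureTheory ProbabilityTheory Filter Topology
open scoped NNReal ENNReal

noncomputable section

namespace HierCoding

/-- The `k`-th smallest value (counted with multiplicity, `1 ≤ k ≤ card ι`) of a finite family of
reals: the least real `t` such that at least `k` of the values are `≤ t`. -/
def kthMin {ι : Type*} [Fintype ι] (k : ℕ) (f : ι → ℝ) : ℝ :=
  sInf {t : ℝ | k ≤ (Finset.univ.filter fun i => f i ≤ t).card}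

/-- The generator (`Q`-matrix) of a finite-state continuous-time Markov chain with transition
rates `r x y` for `x ≠ y`: its rows sum to zero. -/
def generator {S : Type*} [Fintype S] [DecidableEq S] (r : S → S → ℝ) : Matrix S S ℝ :=
  Matrix.of fun x y => if x = y then -∑ z ∈ Finset.univ.erase x, r x z else r x y

/-- `X` is, under `P`, a (right-continuous) continuous-time Markov chain on the finite set `S`
with generator `Q`, started at `x₀`: given the states at times `t 0 ≤ ⋯ ≤ t n`, the probability of
being in `y` at time `t (n + 1) ≥ t n` is the `(x n, y)` entry of `exp ((t (n + 1) - t n) Q)`. -/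
structure IsContinuousTimeMarkovChain {S Ω : Type*} [Fintype S] [DecidableEq S]
    [MeasurableSpace Ω] (Q : Matrix S S ℝ) (x₀ : S) (X : ℝ≥0 → Ω → S) (P : Measure Ω) : Prop where
  measurableSet_eq : ∀ (t : ℝ≥0) (x : S), MeasurableSet {ω | X t ω = x}
  rightContinuous : ∀ (ω : Ω) (t : ℝ≥0), ∀ᶠ s in 𝓝[≥] t, X s ω = X t ω
  initial : ∀ᵐ ω ∂P, X 0 ω = x₀
  markov : ∀ (n : ℕ) (t : ℕ → ℝ≥0) (x : ℕ → S), Monotone t →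
    P.real {ω | ∀ i ≤ n + 1, X (t i) ω = x i} =
      P.real {ω | ∀ i ≤ n, X (t i) ω = x i} *
        NormedSpace.exp (((t (n + 1) : ℝ) - (t n : ℝ)) • Q) (x n) (x (n + 1))

/-- First time (in `[0, ∞]`) at which the process `X` is in `A`; it is `∞` if this never occurs. -/
def hittingTime {S Ω : Type*} (X : ℝ≥0 → Ω → S) (A : Set S) : Ω → ℝ≥0∞ :=
  hittingAfter X A 0

/-- The state space `{0, …, n₂ k₁} × {0, …, k₂}`. -/
abbrev State (n₂ k₁ k₂ : ℕ) : Type := Fin (n₂ * k₁ + 1) × Fin (k₂ + 1)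

/-- The transition rates of the auxiliary chain, from `(u, v) = s` to `s'`. -/
def rate (n₁ n₂ k₁ k₂ : ℕ) (μ₁ μ₂ : ℝ) (s s' : State n₂ k₁ k₂) : ℝ :=
  let u : ℕ := s.1
  let v : ℕ := s.2
  if (s'.1 : ℕ) = u + 1 ∧ (s'.2 : ℕ) = v ∧ v * k₁ ≤ u ∧ u < n₂ * k₁ then
    ((n₁ : ℝ) * n₂ - u) * μ₁
  else if (s'.1 : ℕ) = u ∧ (s'.2 : ℕ) = v + 1 ∧ v < min (u / k₁) k₂ then
    (((u / k₁ : ℕ) : ℝ) - v) * μ₂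
  else 0

/-- The target set `{(u, k₂) : k₂ k₁ ≤ u ≤ n₂ k₁}`. -/
def target (n₂ k₁ k₂ : ℕ) : Set (State n₂ k₁ k₂) :=
  {s | (s.2 : ℕ) = k₂ ∧ k₂ * k₁ ≤ (s.1 : ℕ)}

/-- The random variable `k₂-th min_{i ∈ [n₂]} (T_i^{(c)} + T_{(i k₁)})`, where `T_{(m)}` is the
`m`-th smallest of all the `T i j`. The index `i : Fin n₂` stands for `i + 1 ∈ [n₂]`. -/
def lowerBoundTime {n₁ n₂ : ℕ} (k₁ k₂ : ℕ) {Ω : Type*} (T : Fin n₂ → Fin n₁ → Ω → ℝ)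
    (Tc : Fin n₂ → Ω → ℝ) (ω : Ω) : ℝ :=
  kthMin k₂ fun i : Fin n₂ =>
    Tc i ω + kthMin (((i : ℕ) + 1) * k₁) fun p : Fin n₂ × Fin n₁ => T p.1 p.2 ω

end HierCoding

end

/-! Both expectations equal the number `hitMean … 0 0`, the solution of one first-step recursion.

On the side of the latencies, all `T i j` and `Tc i` are independent exponential clocks. Group `i`
starts its second-stage clock once enough first-stage clocks have rung. Let `D` and `A` be the sets
of first-stage and second-stage clocks that have rung. By memorylessness, the next ring comes after
an exponential time whose rate is the sum of the running rates, and it leaves the residual times of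
the others fresh (`lintegral_pi_expMeasure_race`). If it comes after time `s`, the latency is `s`
plus the latency of the residual clocks (`latency_eq_add`). The numbers of running clocks depend
only on `u = D.card` and `v = A.card`, and the total rates are those of the chain. So the expected
residual latency satisfies the recursion `expectedTime` (`lintegral_latency_residual`). After `n₂ *
k₁` first-stage rings the remaining ones affect no group and are dropped.

On the side of the chain, `h = hitMean` solves `Q h = -1` at reachable states off the target and
vanishes on the target. Since the target is closed, `P(X t ∉ target)` is the tail of the hitting
time. It is also minus the derivative of `E[h (X t)]`, so integrating over `t` gives `h x₀`
(`lintegral_hittingTime`). -/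

noncomputable section

namespace HierCoding

/-! ### Exponentials of generators -/

section MatrixExp

variable {S : Type*} [Fintype S] [DecidableEq S]

/-- `B` is closed under the jumps with generator `Q`. -/
def IsClosedClass (Q : Matrix S S ℝ) (B : Set S) : Prop :=
  ∀ x ∈ B, ∀ y ∉ B, Q x y = 0

/-- Graded by membership in `B`, the matrix `Q` is block triangular, and the exponential preserves
this. -/
lemma IsClosedClass.exp_apply_eq_zero {Q : Matrix S S ℝ} {B : Set S} (hB : IsClosedClass Q B)
    (t : ℝ) {x y : S} (hx : x ∈ B) (hy : y ∉ B) : NormedSpace.exp (t • Q) x y = 0 := by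
  classical
  have h : (t • Q).BlockTriangular (fun x => if x ∈ B then (1 : ℕ) else 0) := by
    intro x y hxy
    by_cases hx : x ∈ B <;> by_cases hy : y ∈ B <;> simp_all [hB x]
  exact h.exp (by simp [hx, hy])

lemma hasDerivAt_exp_smul_apply (Q : Matrix S S ℝ) (x y : S) (t : ℝ) :
    HasDerivAt (fun s : ℝ => NormedSpace.exp (s • Q) x y) ((NormedSpace.exp (t • Q) * Q) x y) t := by
  open scoped Matrix.Norms.Operator in
  have h : HasDerivAt (fun s : ℝ => NormedSpace.exp (s • Q)) (NormedSpace.exp (t • Q) * Q) t :=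
    hasDerivAt_exp_smul_const Q t
  let ev : Matrix S S ℝ →L[ℝ] ℝ := LinearMap.toContinuousLinearMap (Matrix.entryLinearMap ℝ ℝ x y)
  exact ev.hasFDerivAt.comp_hasDerivAt t h

end MatrixExp

/-! ### Hitting times of right-continuous paths -/

section HittingTime

variable {S Ω : Type*} {X : ℝ≥0 → Ω → S} {A : Set S} {ω : Ω}

lemma hittingTime_lt_iff {t : ℝ≥0} : hittingTime X A ω < t ↔ ∃ s < t, X s ω ∈ A := by
  refine (hittingAfter_lt_iff (u := X) (s := A) (n := 0) (ω := ω) (i := t)).trans ?_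
  simp

lemma notMem_of_lt_hittingTime {t : ℝ≥0} (h : t < hittingTime X A ω) : X t ω ∉ A :=
  notMem_of_lt_hittingAfter (u := X) (s := A) (n := 0) h zero_le

/-- The path is constant on some `[s, u)`, which contains rational times. This reduces hitting
events to countable unions. -/
lemma exists_nnrat_mem {s t : ℝ≥0} (hst : s < t) (hs : X s ω ∈ A)
    (hX : ∀ᶠ r in 𝓝[≥] s, X r ω = X s ω) : ∃ q : ℚ≥0, s < (q : ℝ≥0) ∧ (q : ℝ≥0) < t ∧
      X (q : ℝ≥0) ω ∈ A := by
  obtain ⟨u, hu, hsub⟩ := (mem_nhdsGE_iff_exists_Ico_subset' hst).1 hX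
  obtain ⟨q, hq1, hq2⟩ := exists_rat_btwn (NNReal.coe_lt_coe.2 (lt_min hu hst))
  have hq0 : 0 ≤ q := by
    have : (0 : ℝ) < q := lt_of_le_of_lt s.2 hq1
    exact_mod_cast this.le
  lift q to ℚ≥0 using hq0
  have hq : ((q : ℝ≥0) : ℝ) = ((q : ℚ) : ℝ) := by push_cast; rfl
  have h1 : s < (q : ℝ≥0) :=
    NNReal.coe_lt_coe.1 (hq1.trans_eq hq.symm)
  have h2 : (q : ℝ≥0) < min u t :=
    NNReal.coe_lt_coe.1 (hq.trans_lt hq2)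
  refine ⟨q, h1, h2.trans_le (min_le_right _ _), ?_⟩
  have : X (q : ℝ≥0) ω = X s ω := hsub ⟨h1.le, h2.trans_le (min_le_left _ _)⟩
  rwa [this]

lemma hittingTime_lt_iff_nnrat (hX : ∀ t : ℝ≥0, ∀ᶠ s in 𝓝[≥] t, X s ω = X t ω) {t : ℝ≥0} :
    hittingTime X A ω < t ↔ ∃ q : ℚ≥0, (q : ℝ≥0) < t ∧ X (q : ℝ≥0) ω ∈ A := by
  rw [hittingTime_lt_iff]
  constructor
  · rintro ⟨s, hst, hs⟩
    obtain ⟨q, -, h, h'⟩ := exists_nnrat_mem hst hs (hX s)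
    exact ⟨q, h, h'⟩
  · rintro ⟨q, h, h'⟩
    exact ⟨q, h, h'⟩

/-- The hitting time is attained by a right-continuous process. -/
lemma mem_of_hittingTime_eq (hX : ∀ t : ℝ≥0, ∀ᶠ s in 𝓝[≥] t, X s ω = X t ω) {t : ℝ≥0}
    (h : hittingTime X A ω = t) : X t ω ∈ A := by
  obtain ⟨u, hu, hsub⟩ := (mem_nhdsGE_iff_exists_Ico_subset' (lt_add_one t)).1 (hX t)
  have hlt : hittingTime X A ω < u := by
    rw [h]; exact_mod_cast hu
  obtain ⟨s, hsu, hs⟩ := hittingTime_lt_iff.1 hlt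
  have hts : t ≤ s := by
    by_contra! hst
    have := hittingTime_lt_iff.2 ⟨s, hst, hs⟩
    exact (h ▸ this).false
  have : X s ω = X t ω := hsub ⟨hts, hsu⟩
  rwa [← this]

lemma measurable_hittingTime [MeasurableSpace Ω]
    (hm : ∀ t : ℝ≥0, MeasurableSet {ω | X t ω ∈ A})
    (hX : ∀ (ω : Ω) (t : ℝ≥0), ∀ᶠ s in 𝓝[≥] t, X s ω = X t ω) :
    Measurable (hittingTime X A) := by
  refine measurable_of_Iio fun a => ?_
  have : hittingTime X A ⁻¹' Set.Iio a =
      ⋃ q : ℚ≥0, ⋃ _ : ((q : ℝ≥0) : ℝ≥0∞) < a, {ω | X (q : ℝ≥0) ω ∈ A} := by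
    ext ω
    simp only [Set.mem_preimage, Set.mem_Iio, Set.mem_iUnion, exists_prop, Set.mem_ofPred_eq]
    constructor
    · intro h
      obtain ⟨t, ht, hta⟩ := ENNReal.lt_iff_exists_nnreal_btwn.1 h
      obtain ⟨q, hq, hqA⟩ := (hittingTime_lt_iff_nnrat (hX ω)).1 ht
      exact ⟨q, (ENNReal.coe_lt_coe.2 hq).trans hta, hqA⟩
    · rintro ⟨q, hq, hqA⟩
      refine lt_of_le_of_lt ?_ hq
      by_contra! h
      exact notMem_of_lt_hittingTime h hqA
  rw [this]
  exact MeasurableSet.iUnion fun q => MeasurableSet.iUnion fun _ => hm q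

end HittingTime

/-! ### Expected hitting time of a closed set from `Q h = -1` -/

section Chain

variable {S Ω : Type*} [Fintype S] [DecidableEq S] [MeasurableSpace Ω] {Q : Matrix S S ℝ} {x₀ : S}
  {X : ℝ≥0 → Ω → S} {P : Measure Ω}

namespace IsContinuousTimeMarkovChain

lemma measurableSet_mem (hX : IsContinuousTimeMarkovChain Q x₀ X P) (t : ℝ≥0) (A : Set S) :
    MeasurableSet {ω | X t ω ∈ A} := by
  have : {ω | X t ω ∈ A} = ⋃ y ∈ A, {ω | X t ω = y} := by ext; simp
  rw [this]
  exact MeasurableSet.biUnion A.to_countable fun y _ => hX.measurableSet_eq t y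

lemma measureReal_two_times (hX : IsContinuousTimeMarkovChain Q x₀ X P) {s t : ℝ≥0} (hst : s ≤ t)
    (x y : S) : P.real {ω | X s ω = x ∧ X t ω = y} =
      P.real {ω | X s ω = x} * NormedSpace.exp (((t : ℝ) - s) • Q) x y := by
  -- Only indices `0` and `1` matter, but the Markov property asks for a monotone sequence on all of
  -- `ℕ`.
  have hmono : Monotone (fun i : ℕ => if i = 0 then s else t) := by
    intro i j hij
    by_cases hi : i = 0 <;> by_cases hj : j = 0 <;> simp_all
  have h := hX.markov 0 _ (fun i => if i = 0 then x else y) hmono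
  have h1 : {ω | ∀ i ≤ 0 + 1, X (if i = 0 then s else t) ω = if i = 0 then x else y} =
      {ω | X s ω = x ∧ X t ω = y} := by
    ext ω
    simp only [Set.mem_ofPred_eq]
    refine ⟨fun h => ⟨by simpa using h 0 (by simp), by simpa using h 1 (by simp)⟩, ?_⟩
    rintro ⟨h0, h1⟩ i hi
    by_cases hi : i = 0 <;> simp_all
  have h2 : {ω | ∀ i ≤ 0, X (if i = 0 then s else t) ω = if i = 0 then x else y} =
      {ω | X s ω = x} := by
    ext ω; simp
  rw [h1, h2] at h
  simpa using h

variable [IsProbabilityMeasure P]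

lemma measureReal_eq (hX : IsContinuousTimeMarkovChain Q x₀ X P) (t : ℝ≥0) (y : S) :
    P.real {ω | X t ω = y} = NormedSpace.exp ((t : ℝ) • Q) x₀ y := by
  have h := hX.measureReal_two_times (zero_le (a := t)) x₀ y
  have h0 : P.real {ω | X 0 ω = x₀} = 1 := by
    rw [measureReal_def, (mem_ae_iff_prob_eq_one (hX.measurableSet_eq 0 x₀)).1 hX.initial,
      ENNReal.toReal_one]
  have h1 : P.real {ω | X 0 ω = x₀ ∧ X t ω = y} = P.real {ω | X t ω = y} := by
    refine measureReal_congr ?_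
    filter_upwards [hX.initial] with ω hω
    exact propext ⟨fun h => h.2, fun h => ⟨hω, h⟩⟩
  rw [h1, h0] at h
  simpa using h

lemma ae_mem_of_mem (hX : IsContinuousTimeMarkovChain Q x₀ X P) {A : Set S}
    (hA : IsClosedClass Q A) {s t : ℝ≥0} (hst : s ≤ t) :
    ∀ᵐ ω ∂P, X s ω ∈ A → X t ω ∈ A := by
  have h : ∀ᵐ ω ∂P, ∀ x y : S, x ∈ A → y ∉ A → ¬ (X s ω = x ∧ X t ω = y) := by
    rw [ae_all_iff]; intro x
    rw [ae_all_iff]; intro y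
    by_cases hx : x ∈ A
    · by_cases hy : y ∈ A
      · simp [hy]
      · have h := hX.measureReal_two_times hst x y
        rw [hA.exp_apply_eq_zero _ hx hy, mul_zero, measureReal_eq_zero_iff] at h
        have h' : ∀ᵐ ω ∂P, ¬ (X s ω = x ∧ X t ω = y) := by
          rw [ae_iff]; simpa only [not_not] using h
        filter_upwards [h'] with ω hω _ _ using hω
    · simp [hx]
  filter_upwards [h] with ω hω hs
  by_contra ht
  exact hω _ _ hs ht ⟨rfl, rfl⟩

open Classical in
lemma measureReal_notMem (hX : IsContinuousTimeMarkovChain Q x₀ X P) (A : Set S) (t : ℝ≥0) :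
    P.real {ω | X t ω ∉ A} =
      ∑ y, if y ∈ A then 0 else NormedSpace.exp ((t : ℝ) • Q) x₀ y := by
  have : {ω | X t ω ∉ A} = ⋃ y ∈ Finset.univ.filter (· ∉ A), {ω | X t ω = y} := by ext; simp
  rw [this, measureReal_biUnion_finset]
  · simp_rw [hX.measureReal_eq, Finset.sum_filter, ite_not]
  · intro x _ y _ hxy
    refine Set.disjoint_left.2 fun ω h1 h2 => hxy ?_
    exact h1.symm.trans h2
  · exact fun y _ => hX.measurableSet_eq t y

/-- Let `A` be closed and let `h ≥ 0` vanish on `A` and satisfy `Q h = -1` outside `A`, on a closed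
class `B` containing the initial state. Then the expected hitting time of `A` is `h x₀`. -/
theorem lintegral_hittingTime (hX : IsContinuousTimeMarkovChain Q x₀ X P) {A B : Set S}
    (hA : IsClosedClass Q A) (hB : IsClosedClass Q B) (hx₀ : x₀ ∈ B) {h : S → ℝ}
    (h_nonneg : ∀ x, 0 ≤ h x) (h_zero : ∀ x ∈ A, h x = 0)
    (h_eq : ∀ x ∈ B, x ∉ A → ∑ y, Q x y * h y = -1) :
    ∫⁻ ω, hittingTime X A ω ∂P = ENNReal.ofReal (h x₀) := by
  classical
  set p : ℝ → S → ℝ := fun t y => NormedSpace.exp (t • Q) x₀ y with hp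
  set g : ℝ → ℝ := fun t => ∑ y, if y ∈ A then 0 else p t y with hg
  set φ : ℝ → ℝ := fun t => ∑ y, p t y * h y with hφ
  have hgP : ∀ t : ℝ≥0, g t = P.real {ω | X t ω ∉ A} := fun t => (hX.measureReal_notMem A t).symm
  have hp_nonneg : ∀ t : ℝ, 0 ≤ t → ∀ y, 0 ≤ p t y := by
    intro t ht y
    lift t to ℝ≥0 using ht
    rw [hp]
    simp only
    rw [← hX.measureReal_eq]
    exact measureReal_nonneg
  have hφ_nonneg : ∀ t : ℝ, 0 ≤ t → 0 ≤ φ t := fun t ht =>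
    Finset.sum_nonneg fun y _ => mul_nonneg (hp_nonneg t ht y) (h_nonneg y)
  have hg_nonneg : ∀ t : ℝ, 0 ≤ t → 0 ≤ g t := fun t ht =>
    Finset.sum_nonneg fun y _ => by split_ifs <;> simp [hp_nonneg t ht y]
  have hg_anti : ∀ s t : ℝ, 0 ≤ s → s ≤ t → g t ≤ g s := by
    intro s t hs hst
    lift s to ℝ≥0 using hs
    lift t to ℝ≥0 using s.2.trans hst
    rw [hgP, hgP]
    refine ENNReal.toReal_mono (measure_ne_top _ _) (measure_mono_ae ?_)
    filter_upwards [hX.ae_mem_of_mem hA (NNReal.coe_le_coe.1 hst)] with ω hω h1 h2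
    exact h1 (hω h2)
  -- Kolmogorov's forward equation for `φ t = E[h (X t)]`. In the sum over `x`, `Q h` is `0` on `A`
  -- since `A` is closed, it is `-1` on `B \ A`, and outside `B` the weight `p t x` vanishes.
  have hφ_deriv : ∀ t, HasDerivAt φ (-g t) t := by
    intro t
    have h1 : HasDerivAt φ (∑ y, (NormedSpace.exp (t • Q) * Q) x₀ y * h y) t :=
      HasDerivAt.fun_sum fun y _ => (hasDerivAt_exp_smul_apply Q x₀ y t).mul_const _
    convert h1 using 1
    simp_rw [Matrix.mul_apply, Finset.sum_mul]
    rw [Finset.sum_comm, hg, ← Finset.sum_neg_distrib]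
    refine Finset.sum_congr rfl fun x _ => ?_
    simp_rw [mul_assoc, ← Finset.mul_sum]
    by_cases hxA : x ∈ A
    · have : ∑ y, Q x y * h y = 0 := Finset.sum_eq_zero fun y _ => by
        by_cases hy : y ∈ A
        · simp [h_zero y hy]
        · simp [hA x hxA y hy]
      simp [hxA, this]
    · by_cases hxB : x ∈ B
      · simp [hxA, h_eq x hxB hxA, hp]
      · simp [hxA, hp, hB.exp_apply_eq_zero t hx₀ hxB]
  have hφ0 : φ 0 = h x₀ := by
    simp [hφ, hp, Matrix.one_apply]
  -- The mean value theorem gives `φ 0 - φ t = t * g ξ` with `ξ < t`, and `g` is antitone.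
  have hg_le : ∀ t : ℝ, 0 < t → g t ≤ h x₀ / t := by
    intro t ht
    obtain ⟨ξ, hξ, hs⟩ := exists_hasDerivAt_eq_slope φ (fun t => -g t) ht
      (fun x _ => (hφ_deriv x).continuousAt.continuousWithinAt) fun x _ => hφ_deriv x
    calc g t ≤ g ξ := hg_anti _ _ hξ.1.le hξ.2.le
      _ = (h x₀ - φ t) / t := by
        rw [← neg_neg (g ξ), hs, hφ0, sub_zero]; ring
      _ ≤ h x₀ / t := by
        gcongr
        linarith [hφ_nonneg t ht.le]
  have hg_tendsto : Tendsto g atTop (𝓝 0) := by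
    refine tendsto_of_tendsto_of_tendsto_of_le_of_le' tendsto_const_nhds
      (tendsto_const_nhds.div_atTop tendsto_id : Tendsto (fun t : ℝ => h x₀ / t) atTop (𝓝 0)) ?_ ?_
    · filter_upwards [eventually_ge_atTop 0] with t ht using hg_nonneg t ht
    · filter_upwards [eventually_gt_atTop 0] with t ht using hg_le t ht
  -- As `h` vanishes on `A` and is bounded by its sum, the decay of `g` forces that of `φ`.
  have hφ_le : ∀ t : ℝ, 0 ≤ t → φ t ≤ (∑ y, h y) * g t := by
    intro t ht
    rw [hg, Finset.mul_sum]
    refine Finset.sum_le_sum fun y _ => ?_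
    by_cases hy : y ∈ A
    · simp [hy, h_zero y hy]
    · simp only [hy, if_false]
      rw [mul_comm]
      exact mul_le_mul_of_nonneg_right
        (Finset.single_le_sum (fun y _ => h_nonneg y) (Finset.mem_univ y)) (hp_nonneg t ht y)
  have hφ_tendsto : Tendsto φ atTop (𝓝 0) := by
    refine tendsto_of_tendsto_of_tendsto_of_le_of_le' tendsto_const_nhds
      (by simpa using hg_tendsto.const_mul (∑ y, h y)) ?_ ?_
    · filter_upwards [eventually_ge_atTop 0] with t ht using hφ_nonneg t ht
    · filter_upwards [eventually_ge_atTop 0] with t ht using hφ_le t ht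
  have hint : ∫⁻ t in Set.Ioi (0 : ℝ), ENNReal.ofReal (g t) = ENNReal.ofReal (h x₀) := by
    have hnp : ∀ t ∈ Set.Ioi (0 : ℝ), -g t ≤ 0 := fun t ht => by
      simpa using hg_nonneg t (le_of_lt ht)
    have hi := integrableOn_Ioi_deriv_of_nonpos' (fun t _ => hφ_deriv t) hnp hφ_tendsto
    have he := integral_Ioi_of_hasDerivAt_of_nonpos' (fun t _ => hφ_deriv t) hnp hφ_tendsto
    have hi' : IntegrableOn g (Set.Ioi 0) := by simpa using hi.neg
    rw [← ofReal_integral_eq_lintegral_ofReal hi']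
    · rw [integral_neg, hφ0] at he
      congr 1; linarith
    · filter_upwards [ae_restrict_mem measurableSet_Ioi] with t ht using hg_nonneg t (le_of_lt ht)
  have hmeas : Measurable (hittingTime X A) :=
    measurable_hittingTime (fun t => hX.measurableSet_mem t A) hX.rightContinuous
  have hfin : ∀ᵐ ω ∂P, hittingTime X A ω ≠ ∞ := by
    have hle : ∀ n : ℕ, P.real {ω | hittingTime X A ω = ∞} ≤ g n := by
      intro n
      have := hgP n
      rw [NNReal.coe_natCast] at this
      rw [this]
      refine measureReal_mono fun ω hω => ?_
      refine notMem_of_lt_hittingTime ?_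
      rw [Set.mem_ofPred_eq] at hω
      rw [hω]; exact ENNReal.coe_lt_top
    have h0 : P.real {ω | hittingTime X A ω = ∞} ≤ 0 :=
      ge_of_tendsto' (hg_tendsto.comp tendsto_natCast_atTop_atTop) hle
    have h1 : P.real {ω | hittingTime X A ω = ∞} = 0 := le_antisymm h0 measureReal_nonneg
    rw [measureReal_eq_zero_iff] at h1
    rw [ae_iff]
    simpa using h1
  calc ∫⁻ ω, hittingTime X A ω ∂P
      = ∫⁻ ω, ENNReal.ofReal (hittingTime X A ω).toReal ∂P := by
        refine lintegral_congr_ae ?_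
        filter_upwards [hfin] with ω hω
        rw [ENNReal.ofReal_toReal hω]
    _ = ∫⁻ t in Set.Ioi (0 : ℝ), P {ω | t < (hittingTime X A ω).toReal} :=
        lintegral_eq_lintegral_meas_lt P (Eventually.of_forall fun ω => ENNReal.toReal_nonneg)
          hmeas.ennreal_toReal.aemeasurable
    _ = ∫⁻ t in Set.Ioi (0 : ℝ), ENNReal.ofReal (g t) := by
        refine setLIntegral_congr_fun measurableSet_Ioi fun t ht => ?_
        have ht : (0 : ℝ) ≤ t := le_of_lt ht
        lift t to ℝ≥0 using ht
        rw [hgP, ofReal_measureReal]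
        refine measure_congr ?_
        -- The null set in `ae_mem_of_mem` depends on the two times, so only countably many earlier
        -- times can be treated at once.
        have hq : ∀ᵐ ω ∂P, ∀ q : ℚ≥0, (q : ℝ≥0) ≤ t → X (q : ℝ≥0) ω ∈ A → X t ω ∈ A := by
          rw [ae_all_iff]; intro q
          by_cases hqt : (q : ℝ≥0) ≤ t
          · filter_upwards [hX.ae_mem_of_mem hA hqt] with ω hω _ using hω
          · simp [hqt]
        filter_upwards [hfin, hq] with ω hω hqω
        refine propext ?_
        change (t : ℝ) < (hittingTime X A ω).toReal ↔ X t ω ∉ A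
        have hlift : (t : ℝ) < (hittingTime X A ω).toReal ↔ (t : ℝ≥0∞) < hittingTime X A ω := by
          rw [← ENNReal.ofReal_lt_iff_lt_toReal t.coe_nonneg hω, ENNReal.ofReal_coe_nnreal]
        rw [hlift]
        refine ⟨notMem_of_lt_hittingTime, fun hnot => ?_⟩
        by_contra! hle
        rcases hle.lt_or_eq with hlt | heq
        · obtain ⟨q, hqt, hqA⟩ := (hittingTime_lt_iff_nnrat (hX.rightContinuous ω)).1 hlt
          exact hnot (hqω q hqt.le hqA)
        · exact hnot (mem_of_hittingTime_eq (hX.rightContinuous ω) heq)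
    _ = ENNReal.ofReal (h x₀) := hint

end IsContinuousTimeMarkovChain

end Chain

/-! ### The exponential distribution -/

section Exponential

lemma measurable_exponentialPDF (r : ℝ) : Measurable (exponentialPDF r) :=
  (measurable_exponentialPDFReal r).ennreal_ofReal

lemma expMeasure_eq_withDensity (r : ℝ) :
    expMeasure r = volume.withDensity (exponentialPDF r) := rfl

lemma lintegral_expMeasure (r : ℝ) {f : ℝ → ℝ≥0∞} (hf : Measurable f) :
    ∫⁻ x, f x ∂expMeasure r = ∫⁻ x, exponentialPDF r x * f x := by
  rw [expMeasure_eq_withDensity, lintegral_withDensity_eq_lintegral_mul _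
    (measurable_exponentialPDF r) hf]
  rfl

lemma nullSingletonClass_expMeasure (r : ℝ) : NullSingletonClass (expMeasure r) where
  measure_singleton x := withDensity_absolutelyContinuous _ _ (measure_singleton x)

lemma ae_nonneg_expMeasure (r : ℝ) : ∀ᵐ x ∂expMeasure r, 0 ≤ x := by
  rw [ae_iff, expMeasure_eq_withDensity, withDensity_apply _ (by measurability)]
  simpa [Set.Iio] using lintegral_exponentialPDF_of_nonpos (r := r) (le_refl 0)

/-- Memorylessness of the exponential distribution. -/
lemma expMeasure_restrict_Ici (r : ℝ) {s : ℝ} (hs : 0 ≤ s) :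
    (expMeasure r).restrict (Set.Ici s) =
      ENNReal.ofReal (Real.exp (-(r * s))) • (expMeasure r).map (· + s) := by
  ext B hB
  have hm : Measurable (· + s : ℝ → ℝ) := measurable_add_const s
  rw [Measure.restrict_apply hB, Measure.smul_apply, Measure.map_apply hm hB,
    expMeasure_eq_withDensity, withDensity_apply _ (hB.inter measurableSet_Ici),
    withDensity_apply _ (hm hB), ← lintegral_indicator (hB.inter measurableSet_Ici),
    ← lintegral_indicator (hm hB), smul_eq_mul, ← lintegral_const_mul _
      ((measurable_exponentialPDF r).indicator (hm hB)), ← lintegral_add_right_eq_self _ s]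
  refine lintegral_congr fun x => ?_
  by_cases hx : 0 ≤ x
  · by_cases hxB : x + s ∈ B
    · rw [Set.indicator_of_mem (by simp [hxB, hx]), Set.indicator_of_mem (by simpa using hxB),
        exponentialPDF_of_nonneg (by positivity), exponentialPDF_of_nonneg hx,
        ← ENNReal.ofReal_mul (Real.exp_nonneg _)]
      congr 1
      rw [mul_add, neg_add, Real.exp_add]; ring
    · rw [Set.indicator_of_notMem (by simp [hxB]), Set.indicator_of_notMem (by simpa using hxB),
        mul_zero]
  · rw [Set.indicator_of_notMem (by simp [hx]), Set.indicator_apply_eq_zero.2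
      fun _ => exponentialPDF_of_neg (not_le.1 hx), mul_zero]

/-- The weight is the probability that competitors of total rate `m` survive until `s`. The product
of densities is the winning probability `r / (m + r)` times the density of the minimum. -/
lemma lintegral_exp_mul_expMeasure {r m : ℝ} (hr : 0 < r) (hm : 0 ≤ m) {f : ℝ → ℝ≥0∞}
    (hf : Measurable f) :
    ∫⁻ s, ENNReal.ofReal (Real.exp (-(m * s))) * f s ∂expMeasure r =
      ENNReal.ofReal (r / (m + r)) * ∫⁻ s, f s ∂expMeasure (m + r) := by
  rw [lintegral_expMeasure _ (by fun_prop), lintegral_expMeasure _ hf, ← lintegral_const_mul _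
    (f := fun x => exponentialPDF (m + r) x * f x) ((measurable_exponentialPDF _).mul hf)]
  refine lintegral_congr fun s => ?_
  rw [← mul_assoc, ← mul_assoc]
  congr 1
  rcases lt_or_ge s 0 with hs | hs
  · simp [exponentialPDF_of_neg hs]
  · rw [exponentialPDF_of_nonneg hs, exponentialPDF_of_nonneg hs, ← ENNReal.ofReal_mul (by positivity),
      ← ENNReal.ofReal_mul (by positivity)]
    congr 1
    have he : Real.exp (-((m + r) * s)) = Real.exp (-(r * s)) * Real.exp (-(m * s)) := by
      rw [← Real.exp_add]; ring_nf
    rw [he]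
    field_simp

/-- Up to the factor `1 / r`, the integrand is the Gamma density of shape `2`, whose total mass is
`1`. -/
lemma lintegral_ofReal_expMeasure {r : ℝ} (hr : 0 < r) :
    ∫⁻ s, ENNReal.ofReal s ∂expMeasure r = ENNReal.ofReal (1 / r) := by
  rw [lintegral_expMeasure _ ENNReal.measurable_ofReal]
  calc ∫⁻ x, exponentialPDF r x * ENNReal.ofReal x
      = ∫⁻ x, ENNReal.ofReal (1 / r) * gammaPDF 2 r x := by
        refine lintegral_congr fun x => ?_
        rcases lt_or_ge x 0 with hx | hx
        · simp [exponentialPDF_of_neg hx, gammaPDF_of_neg hx]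
        · rw [exponentialPDF_of_nonneg hx, gammaPDF_of_nonneg hx,
            ← ENNReal.ofReal_mul (by positivity), ← ENNReal.ofReal_mul (by positivity)]
          congr 1
          have : (2 : ℝ) - 1 = 1 := by norm_num
          rw [this, Real.rpow_one, Real.Gamma_two, Real.rpow_two]
          field_simp
    _ = ENNReal.ofReal (1 / r) := by
        have hm : Measurable (gammaPDF 2 r) := (measurable_gammaPDFReal 2 r).ennreal_ofReal
        rw [lintegral_const_mul _ hm, lintegral_gammaPDF_eq_one two_pos hr, mul_one]

end Exponential

/-! ### The race of independent exponential clocks -/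

section Race

variable {ι : Type*} [Fintype ι] [DecidableEq ι]

/-- Resampling one coordinate does not change a product measure. -/
lemma lintegral_pi_eq_lintegral_update {μ : ι → Measure ℝ} [∀ i, IsProbabilityMeasure (μ i)]
    (i : ι) {f : (ι → ℝ) → ℝ≥0∞} (hf : Measurable f) :
    ∫⁻ x, f x ∂Measure.pi μ = ∫⁻ s, ∫⁻ x, f (Function.update x i s) ∂Measure.pi μ ∂μ i := by
  have hu : Measurable (fun p : ℝ × (ι → ℝ) => Function.update p.2 i p.1) := by
    refine measurable_pi_lambda _ fun j => ?_
    by_cases hj : j = i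
    · subst hj; simpa using measurable_fst
    · simp only [Function.update_of_ne hj]; fun_prop
  have hmap : Measure.pi μ =
      ((μ i).prod (Measure.pi μ)).map (fun p : ℝ × (ι → ℝ) => Function.update p.2 i p.1) := by
    refine Measure.pi_eq fun s hs => ?_
    rw [Measure.map_apply hu (MeasurableSet.univ_pi hs)]
    have : (fun p : ℝ × (ι → ℝ) => Function.update p.2 i p.1) ⁻¹' Set.univ.pi s =
        s i ×ˢ Set.univ.pi (Function.update s i Set.univ) := by
      ext p
      simp only [Set.mem_preimage, Set.mem_univ_pi, Set.mem_prod]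
      constructor
      · refine fun h => ⟨by simpa using h i, fun j => ?_⟩
        by_cases hj : j = i
        · subst hj; simp
        · simpa [hj] using h j
      · rintro ⟨h1, h2⟩ j
        by_cases hj : j = i
        · subst hj; simpa using h1
        · simpa [hj] using h2 j
    rw [this, Measure.prod_prod, Measure.pi_pi, ← Finset.mul_prod_erase _ _ (Finset.mem_univ i),
      ← Finset.mul_prod_erase _ _ (Finset.mem_univ i)]
    simp only [Function.update_self, measure_univ, one_mul]
    congr 1
    refine Finset.prod_congr rfl fun j hj => ?_
    rw [Function.update_of_ne (Finset.ne_of_mem_erase hj)]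
  conv_lhs => rw [hmap]
  rw [lintegral_map hf hu]
  exact lintegral_prod _ (hf.comp hu).aemeasurable

/-- With coordinate `i` resampled to a value `s`, a tie means `x j = s`, which is null because `μ j`
has no atoms. -/
lemma ae_pi_ne {μ : ι → Measure ℝ} [∀ i, IsProbabilityMeasure (μ i)] {i j : ι}
    [NullSingletonClass (μ j)] (hij : i ≠ j) : ∀ᵐ x ∂Measure.pi μ, x i ≠ x j := by
  have hs : MeasurableSet {x : ι → ℝ | x i = x j} :=
    measurableSet_eq_fun (measurable_pi_apply i) (measurable_pi_apply j)
  rw [ae_iff]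
  simp only [ne_eq, not_not]
  rw [← lintegral_indicator_one hs,
    lintegral_pi_eq_lintegral_update i (measurable_one.indicator hs)]
  refine lintegral_eq_zero_of_ae_eq_zero (Eventually.of_forall fun s => ?_)
  have hn : ∀ᵐ x ∂Measure.pi μ, x j ≠ s := by
    have : ∀ᵐ y ∂μ j, y ≠ s := by simp [ae_iff]
    exact (Measure.quasiMeasurePreserving_eval μ j).ae this
  refine lintegral_eq_zero_of_ae_eq_zero ?_
  filter_upwards [hn] with x hx
  simp [hij.symm, Ne.symm hx]

/-- The event is a box, so the restriction is again a product and memorylessness applies factor by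
factor. -/
lemma pi_expMeasure_restrict (r : ι → ℝ) (hr : ∀ i, 0 < r i) (K : Finset ι) {s : ℝ} (hs : 0 ≤ s) :
    (Measure.pi fun i => expMeasure (r i)).restrict {x | ∀ j ∈ K, s ≤ x j} =
      ENNReal.ofReal (Real.exp (-((∑ j ∈ K, r j) * s))) •
        (Measure.pi fun i => expMeasure (r i)).map (fun x j => if j ∈ K then x j + s else x j) := by
  have hp : ∀ i, IsProbabilityMeasure (expMeasure (r i)) :=
    fun i => isProbabilityMeasure_expMeasure (hr i)
  have hbox : {x : ι → ℝ | ∀ j ∈ K, s ≤ x j} =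
      Set.univ.pi (fun j => if j ∈ K then Set.Ici s else Set.univ) := by
    ext x
    simp only [Set.mem_ofPred_eq, Set.mem_univ_pi]
    refine forall_congr' fun j => ?_
    by_cases hj : j ∈ K <;> simp [hj]
  have hm : Measurable (fun (x : ι → ℝ) j => if j ∈ K then x j + s else x j) := by
    refine measurable_pi_lambda _ fun j => ?_
    by_cases hj : j ∈ K <;> simp only [hj, if_true, if_false] <;> fun_prop
  rw [hbox, Measure.restrict_pi_pi]
  refine Measure.pi_eq fun B hB => ?_
  have hpre : (fun (x : ι → ℝ) j => if j ∈ K then x j + s else x j) ⁻¹' Set.univ.pi B =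
      Set.univ.pi (fun j => if j ∈ K then (· + s) ⁻¹' B j else B j) := by
    ext x
    simp only [Set.mem_preimage, Set.mem_univ_pi]
    refine forall_congr' fun j => ?_
    by_cases hj : j ∈ K <;> simp [hj]
  rw [Measure.smul_apply, Measure.map_apply hm (MeasurableSet.univ_pi hB), hpre, Measure.pi_pi,
    smul_eq_mul]
  have hc : ENNReal.ofReal (Real.exp (-((∑ j ∈ K, r j) * s))) =
      ∏ j, if j ∈ K then ENNReal.ofReal (Real.exp (-(r j * s))) else 1 := by
    rw [Finset.prod_ite_mem, Finset.univ_inter, ← ENNReal.ofReal_prod_of_nonneg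
      fun _ _ => Real.exp_nonneg _, ← Real.exp_sum, Finset.sum_neg_distrib, Finset.sum_mul]
  rw [hc, ← Finset.prod_mul_distrib]
  refine Finset.prod_congr rfl fun j _ => ?_
  by_cases hj : j ∈ K
  · simp only [hj, if_true]
    rw [expMeasure_restrict_Ici _ hs, Measure.smul_apply,
      Measure.map_apply (measurable_add_const s) (hB j), smul_eq_mul]
  · simp [hj]

/-- The race of the clocks in `J`: either of them may ring first, at an exponential time, after
which the residual times of the others are as fresh as at the start. -/
theorem lintegral_pi_expMeasure_race (r : ι → ℝ) (hr : ∀ i, 0 < r i) {J : Finset ι}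
    (hJ : J.Nonempty) {f : (ι → ℝ) → ℝ≥0∞} (hf : Measurable f) :
    ∫⁻ x, f x ∂Measure.pi (fun i => expMeasure (r i)) =
      ∑ i ∈ J, ∫⁻ s, ENNReal.ofReal (Real.exp (-((∑ j ∈ J.erase i, r j) * s))) *
        ∫⁻ x, f (Function.update (fun j => if j ∈ J then x j + s else x j) i s)
          ∂Measure.pi (fun i => expMeasure (r i)) ∂expMeasure (r i) := by
  have hp : ∀ i, IsProbabilityMeasure (expMeasure (r i)) :=
    fun i => isProbabilityMeasure_expMeasure (hr i)
  have hna : ∀ i, NullSingletonClass (expMeasure (r i)) := fun i => nullSingletonClass_expMeasure (r i)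
  set F : ι → Set (ι → ℝ) := fun i => {x | ∀ j ∈ J, x i ≤ x j} with hF
  have hFm : ∀ i, MeasurableSet (F i) := fun i => by
    have : F i = ⋂ j ∈ J, {x | x i ≤ x j} := by ext; simp [hF]
    rw [this]
    exact Finset.measurableSet_biInter _ fun j _ =>
      measurableSet_le (measurable_pi_apply i) (measurable_pi_apply j)
  have hne : ∀ᵐ x ∂Measure.pi (fun i => expMeasure (r i)), ∀ i j, i ≠ j → x i ≠ x j := by
    rw [ae_all_iff]; intro i
    rw [ae_all_iff]; intro j
    by_cases hij : i = j
    · simp [hij]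
    · filter_upwards [ae_pi_ne (μ := fun i => expMeasure (r i)) hij] with x hx _ using hx
  -- Without ties, exactly one clock of `J` is minimal, so the sets `F i` partition the space up to
  -- a null set.
  have hsum : ∀ᵐ x ∂Measure.pi (fun i => expMeasure (r i)),
      f x = ∑ i ∈ J, (F i).indicator f x := by
    filter_upwards [hne] with x hx
    obtain ⟨i, hi, hmin⟩ := J.exists_min_image x hJ
    rw [Finset.sum_eq_single_of_mem i hi, Set.indicator_of_mem (show x ∈ F i from hmin)]
    intro j hj hji
    refine Set.indicator_of_notMem (fun h : x ∈ F j => ?_) _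
    exact hx j i hji (le_antisymm (h i hi) (hmin j hj))
  rw [lintegral_congr_ae hsum, lintegral_finsetSum _ fun i _ => hf.indicator (hFm i)]
  refine Finset.sum_congr rfl fun i hi => ?_
  -- Once the winner's time is fixed to `s`, the event `F i` says only that every other clock of `J`
  -- is at least `s`.
  rw [lintegral_pi_eq_lintegral_update i (hf.indicator (hFm i))]
  refine lintegral_congr_ae ?_
  filter_upwards [ae_nonneg_expMeasure (r i)] with s hs
  have hG : MeasurableSet {x : ι → ℝ | ∀ j ∈ J.erase i, s ≤ x j} := by
    have : {x : ι → ℝ | ∀ j ∈ J.erase i, s ≤ x j} = ⋂ j ∈ J.erase i, {x | s ≤ x j} := by ext; simp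
    rw [this]
    exact Finset.measurableSet_biInter _ fun j _ =>
      measurableSet_le measurable_const (measurable_pi_apply j)
  have hu : Measurable (fun x : ι → ℝ => Function.update x i s) := by
    refine measurable_pi_lambda _ fun j => ?_
    by_cases hj : j = i
    · subst hj; simp
    · simpa [hj] using measurable_pi_apply j
  have hm : Measurable (fun (x : ι → ℝ) j => if j ∈ J.erase i then x j + s else x j) := by
    refine measurable_pi_lambda _ fun j => ?_
    by_cases hj : j ∈ J.erase i <;> simp only [hj, if_true, if_false] <;> fun_prop
  calc ∫⁻ x, (F i).indicator f (Function.update x i s) ∂Measure.pi (fun i => expMeasure (r i))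
      = ∫⁻ x in {x : ι → ℝ | ∀ j ∈ J.erase i, s ≤ x j}, f (Function.update x i s)
          ∂Measure.pi (fun i => expMeasure (r i)) := by
        rw [← lintegral_indicator hG]
        refine lintegral_congr fun x => ?_
        have hiff : Function.update x i s ∈ F i ↔ x ∈ {x : ι → ℝ | ∀ j ∈ J.erase i, s ≤ x j} := by
          simp only [hF, Set.mem_ofPred_eq, Function.update_self, Finset.mem_erase]
          refine ⟨fun h j hj => by simpa [hj.1] using h j hj.2, fun h j hj => ?_⟩
          by_cases hji : j = i
          · subst hji; simp
          · simpa [hji] using h j ⟨hji, hj⟩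
        by_cases hx : x ∈ {x : ι → ℝ | ∀ j ∈ J.erase i, s ≤ x j}
        · rw [Set.indicator_of_mem hx, Set.indicator_of_mem (hiff.2 hx)]
        · rw [Set.indicator_of_notMem hx, Set.indicator_of_notMem fun h => hx (hiff.1 h)]
    _ = _ := by
        rw [pi_expMeasure_restrict r hr _ hs, lintegral_smul_measure, smul_eq_mul]
        congr 1
        refine (lintegral_map (hf.comp hu) hm).trans (lintegral_congr fun x => ?_)
        refine congrArg f ?_
        ext j
        by_cases hj : j = i
        · subst hj; simp
        · simp [hj]

end Race

/-! ### Order statistics -/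

section KthMin

variable {ι : Type*} [Fintype ι] {k : ℕ} {f g : ι → ℝ}

/-- The infimum is attained: the defining set is a finite union of closed half-lines or
intersections of them. It is bounded below since `1 ≤ k` and nonempty since `k ≤ card ι`. -/
lemma kthMin_le_iff (hk : 1 ≤ k) (hkι : k ≤ Fintype.card ι) {t : ℝ} :
    kthMin k f ≤ t ↔ k ≤ (Finset.univ.filter fun i => f i ≤ t).card := by
  set U : Set ℝ := {t : ℝ | k ≤ (Finset.univ.filter fun i => f i ≤ t).card} with hU
  have hmono : ∀ {a b : ℝ}, a ≤ b → a ∈ U → b ∈ U := fun hab ha =>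
    le_trans ha (Finset.card_le_card (Finset.monotone_filter_right _ fun i _ hi => le_trans hi hab))
  have hne : U.Nonempty := by
    obtain ⟨M, hM⟩ := (Set.finite_range f).bddAbove
    refine ⟨M, ?_⟩
    have : (Finset.univ.filter fun i => f i ≤ M) = Finset.univ :=
      Finset.filter_true_of_mem fun i _ => hM ⟨i, rfl⟩
    rw [hU, Set.mem_ofPred_eq, this]
    exact hkι
  have hbdd : BddBelow U := by
    obtain ⟨m, hm⟩ := (Set.finite_range f).bddBelow
    refine ⟨m, fun t ht => ?_⟩
    obtain ⟨i, hi⟩ := Finset.card_pos.1 (lt_of_lt_of_le hk ht)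
    exact (hm ⟨i, rfl⟩).trans (Finset.mem_filter.1 hi).2
  have hclosed : IsClosed U := by
    have : U = ⋃ B ∈ Finset.univ.powersetCard k, ⋂ i ∈ B, Set.Ici (f i) := by
      ext t
      simp only [hU, Set.mem_ofPred_eq, Set.mem_iUnion, Set.mem_iInter, Set.mem_Ici, exists_prop,
        Finset.mem_powersetCard, Finset.subset_univ, true_and, Finset.le_card_iff_exists_subset_card]
      constructor
      · rintro ⟨B, hB, hc⟩
        exact ⟨B, hc, fun i hi => (Finset.mem_filter.1 (hB hi)).2⟩
      · rintro ⟨B, hc, hB⟩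
        exact ⟨B, fun i hi => by simpa using hB i hi, hc⟩
    rw [this]
    exact (Finset.finite_toSet _).isClosed_biUnion fun B _ =>
      isClosed_biInter fun i _ => isClosed_Ici
  refine ⟨fun h => hmono h (hclosed.csInf_mem hne hbdd), fun h => csInf_le hbdd h⟩

lemma kthMin_nonneg (hk : 1 ≤ k) (hkι : k ≤ Fintype.card ι) (hf : ∀ i, 0 ≤ f i) :
    0 ≤ kthMin k f := by
  obtain ⟨i, hi⟩ := Finset.card_pos.1
    (lt_of_lt_of_le hk ((kthMin_le_iff hk hkι).1 (le_refl (kthMin k f))))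
  exact (hf i).trans (Finset.mem_filter.1 hi).2

lemma kthMin_eq_zero (hk : 1 ≤ k) {A : Finset ι} (hkA : k ≤ A.card) (hf : ∀ i, 0 ≤ f i)
    (hA : ∀ i ∈ A, f i = 0) : kthMin k f = 0 := by
  have hkι : k ≤ Fintype.card ι := hkA.trans (Finset.card_le_univ A)
  refine le_antisymm ((kthMin_le_iff hk hkι).2 ?_) (kthMin_nonneg hk hkι hf)
  exact hkA.trans (Finset.card_le_card fun i hi => by simp [hA i hi])

/-- Delaying by `s` all but fewer than `k` values, which are `0`, delays the `k`-th smallest. -/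
lemma kthMin_eq_add (hkι : k ≤ Fintype.card ι) {A : Finset ι} (hkA : A.card < k) {s : ℝ}
    (hs : 0 ≤ s) (hg : ∀ i, 0 ≤ g i) (hgA : ∀ i ∈ A, g i = 0) (hfA : ∀ i ∈ A, f i = 0)
    (hfg : ∀ i ∉ A, f i = s + g i) : kthMin k f = s + kthMin k g := by
  have hk : 1 ≤ k := by omega
  refine eq_of_forall_ge_iff fun t => ?_
  rw [kthMin_le_iff hk hkι, ← le_sub_iff_add_le', kthMin_le_iff hk hkι]
  -- Before time `s` only the fewer than `k` indices in `A` can count for `f`, and none for `g` at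
  -- `t - s < 0`. From `s` on, the two index sets coincide.
  rcases lt_or_ge t s with ht | ht
  · refine iff_of_false (fun h => ?_) (fun h => ?_)
    · refine absurd (h.trans (Finset.card_le_card (t := A) fun i hi => ?_)) (not_le.2 hkA)
      by_contra hiA
      have h1 := (Finset.mem_filter.1 hi).2
      rw [hfg i hiA] at h1
      linarith [hg i]
    · obtain ⟨i, hi⟩ := Finset.card_pos.1 (lt_of_lt_of_le hk h)
      linarith [hg i, (Finset.mem_filter.1 hi).2]
  · have : (Finset.univ.filter fun i => f i ≤ t) = Finset.univ.filter fun i => g i ≤ t - s := by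
      refine Finset.filter_congr fun i _ => ?_
      by_cases hi : i ∈ A
      · rw [hfA i hi, hgA i hi]
        exact iff_of_true (hs.trans ht) (sub_nonneg.2 ht)
      · rw [hfg i hi, le_sub_iff_add_le']
    rw [this]

lemma measurable_kthMin {α : Type*} [MeasurableSpace α] (hk : 1 ≤ k) (hkι : k ≤ Fintype.card ι)
    {F : α → ι → ℝ} (hF : ∀ i, Measurable fun a => F a i) :
    Measurable fun a => kthMin k (F a) := by
  refine measurable_of_Iic fun t => ?_
  have : (fun a => kthMin k (F a)) ⁻¹' Set.Iic t =
      ⋃ B ∈ Finset.univ.powersetCard k, ⋂ i ∈ B, {a | F a i ≤ t} := by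
    ext a
    simp only [Set.mem_preimage, Set.mem_Iic, kthMin_le_iff hk hkι, Set.mem_ofPred_eq,
      Set.mem_iUnion, Set.mem_iInter, exists_prop,
      Finset.mem_powersetCard, Finset.subset_univ, true_and, Finset.le_card_iff_exists_subset_card]
    constructor
    · rintro ⟨B, hB, hc⟩
      exact ⟨B, hc, fun i hi => (Finset.mem_filter.1 (hB hi)).2⟩
    · rintro ⟨B, hc, hB⟩
      exact ⟨B, fun i hi => by simpa using hB i hi, hc⟩
  rw [this]
  exact Finset.measurableSet_biUnion _ fun B _ => Finset.measurableSet_biInter _ fun i _ =>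
    measurableSet_le (hF i) measurable_const

end KthMin

/-! ### The latency as a function of the residual clocks -/

section Latency

variable {n₁ n₂ k₁ k₂ : ℕ}

/-- The clocks: one for each `T i j` and one for each `Tc i`. -/
abbrev Clock (n₁ n₂ : ℕ) : Type := (Fin n₂ × Fin n₁) ⊕ Fin n₂

/-- `lowerBoundTime` as a function of the values of all clocks. -/
def latency (k₁ k₂ : ℕ) (x : Clock n₁ n₂ → ℝ) : ℝ :=
  lowerBoundTime k₁ k₂ (fun i j (x : Clock n₁ n₂ → ℝ) => x (Sum.inl (i, j)))
    (fun i x => x (Sum.inr i)) x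

lemma latency_eq (x : Clock n₁ n₂ → ℝ) : latency k₁ k₂ x = kthMin k₂ fun i : Fin n₂ =>
    x (Sum.inr i) + kthMin (((i : ℕ) + 1) * k₁) fun p => x (Sum.inl p) := rfl

/-- Indices of the groups that are in service once `u` of the first-stage clocks have rung. -/
def started (n₂ k₁ u : ℕ) : Finset (Fin n₂) := Finset.univ.filter fun i => ((i : ℕ) + 1) * k₁ ≤ u

lemma mem_started {u : ℕ} {i : Fin n₂} : i ∈ started n₂ k₁ u ↔ ((i : ℕ) + 1) * k₁ ≤ u := by
  simp [started]

lemma started_mono {u v : ℕ} (h : u ≤ v) : started n₂ k₁ u ⊆ started n₂ k₁ v := fun _ hi =>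
  mem_started.2 ((mem_started.1 hi).trans h)

/-- Source of the floor `⌊u / k₁⌋` in the transition rates. -/
lemma card_started (hk₁ : 1 ≤ k₁) {u : ℕ} (hu : u ≤ n₂ * k₁) :
    (started n₂ k₁ u).card = u / k₁ := by
  have : started n₂ k₁ u = Finset.univ.filter fun i : Fin n₂ => (i : ℕ) < u / k₁ := by
    refine Finset.filter_congr fun i _ => ?_
    rw [← Nat.le_div_iff_mul_le hk₁, Nat.succ_le_iff]
  rw [this, Fin.card_filter_val_lt, min_eq_right]
  exact Nat.div_le_of_le_mul (by rwa [mul_comm])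

lemma one_le_rank (hk₁ : 1 ≤ k₁) (i : Fin n₂) : 1 ≤ ((i : ℕ) + 1) * k₁ :=
  Nat.mul_pos (Nat.succ_pos _) hk₁

lemma rank_le (i : Fin n₂) : ((i : ℕ) + 1) * k₁ ≤ n₂ * k₁ := Nat.mul_le_mul_right _ i.2

lemma rank_le_card (hkn₁ : k₁ ≤ n₁) (i : Fin n₂) :
    ((i : ℕ) + 1) * k₁ ≤ Fintype.card (Fin n₂ × Fin n₁) := by
  simpa using Nat.mul_le_mul (Nat.succ_le_of_lt i.2) hkn₁

lemma measurable_latency (hk₁ : 1 ≤ k₁) (hkn₁ : k₁ ≤ n₁) (hk₂ : 1 ≤ k₂) (hkn₂ : k₂ ≤ n₂) :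
    Measurable (latency k₁ k₂ : (Clock n₁ n₂ → ℝ) → ℝ) := by
  refine measurable_kthMin hk₂ (by simpa using hkn₂) fun i => (measurable_pi_apply _).add ?_
  exact measurable_kthMin (one_le_rank hk₁ i) (rank_le_card hkn₁ i) fun p => measurable_pi_apply _

lemma latency_nonneg (hk₁ : 1 ≤ k₁) (hkn₁ : k₁ ≤ n₁) (hk₂ : 1 ≤ k₂) (hkn₂ : k₂ ≤ n₂)
    {x : Clock n₁ n₂ → ℝ} (hx : ∀ i, 0 ≤ x i) : 0 ≤ latency k₁ k₂ x :=
  kthMin_nonneg hk₂ (by simpa using hkn₂) fun i => add_nonneg (hx _)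
    (kthMin_nonneg (one_le_rank hk₁ i) (rank_le_card hkn₁ i) fun _ => hx _)

lemma latency_eq_zero (hk₁ : 1 ≤ k₁) (hkn₁ : k₁ ≤ n₁) (hk₂ : 1 ≤ k₂)
    {D : Finset (Fin n₂ × Fin n₁)} {A : Finset (Fin n₂)} (hA : A ⊆ started n₂ k₁ D.card)
    (hA₂ : k₂ ≤ A.card) {x : Clock n₁ n₂ → ℝ} (hx : ∀ i, 0 ≤ x i)
    (hxD : ∀ p ∈ D, x (Sum.inl p) = 0) (hxA : ∀ i ∈ A, x (Sum.inr i) = 0) :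
    latency k₁ k₂ x = 0 := by
  refine kthMin_eq_zero hk₂ hA₂ (fun i => add_nonneg (hx _)
    (kthMin_nonneg (one_le_rank hk₁ i) (rank_le_card hkn₁ i) fun _ => hx _)) fun i hi => ?_
  simp only
  rw [hxA i hi, zero_add]
  exact kthMin_eq_zero (one_le_rank hk₁ i) (mem_started.1 (hA hi)) (fun _ => hx _) hxD

/-- If the clocks in `D` and `A` have rung, and the residual times `y` of all running clocks are by
`s` larger than in `x`, then so is the latency. -/
lemma latency_eq_add (hk₁ : 1 ≤ k₁) (hkn₁ : k₁ ≤ n₁) (hkn₂ : k₂ ≤ n₂)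
    {D : Finset (Fin n₂ × Fin n₁)} {A : Finset (Fin n₂)} (hA : A ⊆ started n₂ k₁ D.card)
    (hA₂ : A.card < k₂) {x y : Clock n₁ n₂ → ℝ} {s : ℝ} (hs : 0 ≤ s)
    (hx : ∀ i, 0 ≤ x i) (hy : ∀ i, 0 ≤ y i)
    (hxD : ∀ p ∈ D, x (Sum.inl p) = 0) (hyD : ∀ p ∈ D, y (Sum.inl p) = 0)
    (hxA : ∀ i ∈ A, x (Sum.inr i) = 0) (hyA : ∀ i ∈ A, y (Sum.inr i) = 0)
    (hxyD : D.card < n₂ * k₁ → ∀ p ∉ D, y (Sum.inl p) = s + x (Sum.inl p))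
    (hxyA : ∀ i ∈ started n₂ k₁ D.card, i ∉ A → y (Sum.inr i) = s + x (Sum.inr i))
    (hxy : ∀ i ∉ started n₂ k₁ D.card, y (Sum.inr i) = x (Sum.inr i)) :
    latency k₁ k₂ y = s + latency k₁ k₂ x := by
  have hx0 : ∀ i ∈ started n₂ k₁ D.card,
      kthMin (((i : ℕ) + 1) * k₁) (fun p => x (Sum.inl p)) = 0 := fun i hi =>
    kthMin_eq_zero (one_le_rank hk₁ i) (mem_started.1 hi) (fun _ => hx _) hxD
  have hy0 : ∀ i ∈ started n₂ k₁ D.card,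
      kthMin (((i : ℕ) + 1) * k₁) (fun p => y (Sum.inl p)) = 0 := fun i hi =>
    kthMin_eq_zero (one_le_rank hk₁ i) (mem_started.1 hi) (fun _ => hy _) hyD
  rw [latency_eq, latency_eq]
  refine kthMin_eq_add (by simpa using hkn₂) hA₂ hs (fun i => add_nonneg (hx _)
    (kthMin_nonneg (one_le_rank hk₁ i) (rank_le_card hkn₁ i) fun _ => hx _)) ?_ ?_ ?_
  · intro i hi
    simp [hxA i hi, hx0 i (hA hi)]
  · intro i hi
    simp [hyA i hi, hy0 i (hA hi)]
  · intro i hi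
    -- The delay `s` enters each unfinished group exactly once: through its own clock if it has
    -- started, otherwise through the order statistic it waits for.
    by_cases hist : i ∈ started n₂ k₁ D.card
    · simp [hx0 i hist, hy0 i hist, hxyA i hist hi]
    · have hlt : D.card < ((i : ℕ) + 1) * k₁ := by simpa [mem_started] using hist
      rw [hxy i hist, kthMin_eq_add (rank_le_card hkn₁ i) hlt hs (fun _ => hx _) hxD hyD
        (hxyD (hlt.trans_le (rank_le i)))]
      ring

end Latency

/-! ### First-step analysis of the expected latency -/

section ExpectedLatency

variable {n₁ n₂ k₁ k₂ : ℕ} {μ₁ μ₂ : ℝ}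

/-- The total rate at which first-stage clocks ring after `u` of them have rung. -/
def rateFst (n₁ n₂ k₁ : ℕ) (μ₁ : ℝ) (u : ℕ) : ℝ :=
  if u < n₂ * k₁ then ((n₁ * n₂ - u : ℕ) : ℝ) * μ₁ else 0

/-- The total rate of the services running when `v` of the `u / k₁` started ones are completed. -/
def rateSnd (k₁ : ℕ) (μ₂ : ℝ) (u v : ℕ) : ℝ := ((u / k₁ - v : ℕ) : ℝ) * μ₂

lemma rateFst_nonneg (hμ₁ : 0 < μ₁) (u : ℕ) : 0 ≤ rateFst n₁ n₂ k₁ μ₁ u := by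
  unfold rateFst; split_ifs <;> positivity

lemma rateSnd_nonneg (hμ₂ : 0 < μ₂) (u v : ℕ) : 0 ≤ rateSnd k₁ μ₂ u v := by
  unfold rateSnd; positivity

/-- The expected time to reach `v = k₂` from `(u, v)`, by first-step analysis; `N` is an upper
bound for the number of steps. -/
def expectedTime (n₁ n₂ k₁ k₂ : ℕ) (μ₁ μ₂ : ℝ) : ℕ → ℕ → ℕ → ℝ
  | 0, _, _ => 0
  | N + 1, u, v =>
    if v < k₂ then
      (1 + rateFst n₁ n₂ k₁ μ₁ u * expectedTime n₁ n₂ k₁ k₂ μ₁ μ₂ N (u + 1) v +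
        rateSnd k₁ μ₂ u v * expectedTime n₁ n₂ k₁ k₂ μ₁ μ₂ N u (v + 1)) /
        (rateFst n₁ n₂ k₁ μ₁ u + rateSnd k₁ μ₂ u v)
    else 0

lemma expectedTime_nonneg (hμ₁ : 0 < μ₁) (hμ₂ : 0 < μ₂) (N u v : ℕ) :
    0 ≤ expectedTime n₁ n₂ k₁ k₂ μ₁ μ₂ N u v := by
  induction N generalizing u v with
  | zero => simp [expectedTime]
  | succ N ih =>
    rw [expectedTime]
    split_ifs
    · have h1 := rateFst_nonneg (n₁ := n₁) (n₂ := n₂) (k₁ := k₁) hμ₁ u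
      have h2 := rateSnd_nonneg (k₁ := k₁) hμ₂ u v
      have h3 := ih (u + 1) v
      have h4 := ih u (v + 1)
      positivity
    · exact le_rfl

lemma expectedTime_of_ge (N u : ℕ) {v : ℕ} (hv : k₂ ≤ v) :
    expectedTime n₁ n₂ k₁ k₂ μ₁ μ₂ N u v = 0 := by
  cases N <;> simp [expectedTime, not_lt.2 hv]

/-- The rates of the clocks. -/
def clockRate (μ₁ μ₂ : ℝ) : Clock n₁ n₂ → ℝ := Sum.elim (fun _ => μ₁) fun _ => μ₂

/-- The clocks in `D` and `A` have rung: their residual times are `0`. -/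
def residual (D : Finset (Fin n₂ × Fin n₁)) (A : Finset (Fin n₂)) (x : Clock n₁ n₂ → ℝ) :
    Clock n₁ n₂ → ℝ :=
  Sum.elim (fun p => if p ∈ D then 0 else x (Sum.inl p)) fun i => if i ∈ A then 0 else x (Sum.inr i)

lemma residual_empty (x : Clock n₁ n₂ → ℝ) : residual ∅ ∅ x = x := by
  ext i
  rcases i with p | i <;> simp [residual]

lemma residual_nonneg (D : Finset (Fin n₂ × Fin n₁)) (A : Finset (Fin n₂)) {x : Clock n₁ n₂ → ℝ}
    (hx : ∀ i, 0 ≤ x i) (i : Clock n₁ n₂) : 0 ≤ residual D A x i := by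
  rcases i with p | i <;> simp only [residual, Sum.elim_inl, Sum.elim_inr] <;> split_ifs <;>
    simp [hx]

lemma measurable_residual (D : Finset (Fin n₂ × Fin n₁)) (A : Finset (Fin n₂)) :
    Measurable (residual D A) := by
  refine measurable_pi_lambda _ fun i => ?_
  rcases i with p | i <;> simp only [residual, Sum.elim_inl, Sum.elim_inr] <;> split_ifs <;>
    fun_prop

/-- The first-stage clocks that still matter. -/
def runningFst (k₁ : ℕ) (D : Finset (Fin n₂ × Fin n₁)) : Finset (Fin n₂ × Fin n₁) :=
  if D.card < n₂ * k₁ then Dᶜ else ∅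

/-- The clocks that are running when those in `D` and `A` have rung. -/
def running (k₁ : ℕ) (D : Finset (Fin n₂ × Fin n₁)) (A : Finset (Fin n₂)) :
    Finset (Clock n₁ n₂) :=
  (runningFst k₁ D).disjSum (started n₂ k₁ D.card \ A)

lemma card_runningFst_mul (D : Finset (Fin n₂ × Fin n₁)) :
    ((runningFst k₁ D).card : ℝ) * μ₁ = rateFst n₁ n₂ k₁ μ₁ D.card := by
  unfold runningFst rateFst
  split_ifs
  · rw [Finset.card_compl, Fintype.card_prod, Fintype.card_fin, Fintype.card_fin, mul_comm n₁]
  · simp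

lemma card_started_sdiff_mul (hk₁ : 1 ≤ k₁) {D : Finset (Fin n₂ × Fin n₁)} {A : Finset (Fin n₂)}
    (hD : D.card ≤ n₂ * k₁) (hA : A ⊆ started n₂ k₁ D.card) :
    ((started n₂ k₁ D.card \ A).card : ℝ) * μ₂ = rateSnd k₁ μ₂ D.card A.card := by
  rw [Finset.card_sdiff_of_subset hA, card_started hk₁ hD, rateSnd]

lemma sum_running (hk₁ : 1 ≤ k₁) {D : Finset (Fin n₂ × Fin n₁)} {A : Finset (Fin n₂)}
    (hD : D.card ≤ n₂ * k₁) (hA : A ⊆ started n₂ k₁ D.card) :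
    ∑ i ∈ running k₁ D A, clockRate μ₁ μ₂ i =
      rateFst n₁ n₂ k₁ μ₁ D.card + rateSnd k₁ μ₂ D.card A.card := by
  rw [running, Finset.sum_disjSum, ← card_runningFst_mul, ← card_started_sdiff_mul hk₁ hD hA]
  simp [clockRate]

/-- Either first-stage clocks remain, or all `n₂ ≥ k₂` groups have started and fewer than `k₂` are
completed. -/
lemma running_nonempty (hk₁ : 1 ≤ k₁) (hkn₁ : k₁ ≤ n₁) (hkn₂ : k₂ ≤ n₂)
    {D : Finset (Fin n₂ × Fin n₁)} {A : Finset (Fin n₂)}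
    (hD : D.card ≤ n₂ * k₁) (hA : A ⊆ started n₂ k₁ D.card) (hA₂ : A.card < k₂) :
    (running k₁ D A).Nonempty := by
  rw [← Finset.card_pos, running, Finset.card_disjSum, Finset.card_sdiff_of_subset hA,
    card_started hk₁ hD]
  rcases hD.lt_or_eq with h | h
  · have : n₂ * k₁ ≤ n₂ * n₁ := Nat.mul_le_mul_left _ hkn₁
    rw [runningFst, if_pos h, Finset.card_compl, Fintype.card_prod, Fintype.card_fin,
      Fintype.card_fin]
    omega
  · rw [h, Nat.mul_div_cancel _ hk₁]
    omega

/-- `latency_eq_add` is applied with the old `D`: the winner's entry `s` is `s + 0`, and the clock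
of a group started by this very ring is still untouched. -/
lemma latency_residual_of_fst (hk₁ : 1 ≤ k₁) (hkn₁ : k₁ ≤ n₁) (hkn₂ : k₂ ≤ n₂)
    {D : Finset (Fin n₂ × Fin n₁)} {A : Finset (Fin n₂)} (hA : A ⊆ started n₂ k₁ D.card)
    (hA₂ : A.card < k₂) {x : Clock n₁ n₂ → ℝ} {s : ℝ} (hs : 0 ≤ s) (hx : ∀ i, 0 ≤ x i)
    {p : Fin n₂ × Fin n₁} (hp : p ∈ runningFst k₁ D) :
    latency k₁ k₂ (residual D A (Function.update
        (fun j => if j ∈ running k₁ D A then x j + s else x j) (Sum.inl p) s)) =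
      s + latency k₁ k₂ (residual (insert p D) A x) := by
  have hDc : D.card < n₂ * k₁ := by
    by_contra h
    simp [runningFst, h] at hp
  have hpD : p ∉ D := by simpa [runningFst, hDc] using hp
  refine latency_eq_add hk₁ hkn₁ hkn₂ hA hA₂ hs (residual_nonneg _ _ hx)
    (residual_nonneg _ _ fun i => ?_) ?_ ?_ ?_ ?_ ?_ ?_ ?_
  · rw [Function.update_apply]
    have := hx i
    split_ifs <;> positivity
  · intro q hq; simp [residual, hq]
  · intro q hq; simp [residual, hq]
  · intro i hi; simp [residual, hi]
  · intro i hi; simp [residual, hi]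
  · intro _ q hq
    by_cases hqp : q = p
    · subst hqp; simp [residual, hq]
    · simp [residual, hq, hqp, running, runningFst, hDc, add_comm]
  · intro i hi hiA
    simp [residual, hi, hiA, running, add_comm]
  · intro i hi
    simp [residual, hi, running]

lemma latency_residual_of_snd (hk₁ : 1 ≤ k₁) (hkn₁ : k₁ ≤ n₁) (hkn₂ : k₂ ≤ n₂)
    {D : Finset (Fin n₂ × Fin n₁)} {A : Finset (Fin n₂)} (hA : A ⊆ started n₂ k₁ D.card)
    (hA₂ : A.card < k₂) {x : Clock n₁ n₂ → ℝ} {s : ℝ} (hs : 0 ≤ s) (hx : ∀ i, 0 ≤ x i)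
    {a : Fin n₂} (ha : a ∈ started n₂ k₁ D.card \ A) :
    latency k₁ k₂ (residual D A (Function.update
        (fun j => if j ∈ running k₁ D A then x j + s else x j) (Sum.inr a) s)) =
      s + latency k₁ k₂ (residual D (insert a A) x) := by
  obtain ⟨ha1, ha2⟩ := Finset.mem_sdiff.1 ha
  refine latency_eq_add hk₁ hkn₁ hkn₂ hA hA₂ hs (residual_nonneg _ _ hx)
    (residual_nonneg _ _ fun i => ?_) ?_ ?_ ?_ ?_ ?_ ?_ ?_
  · rw [Function.update_apply]
    have := hx i
    split_ifs <;> positivity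
  · intro q hq; simp [residual, hq]
  · intro q hq; simp [residual, hq]
  · intro i hi; simp [residual, hi]
  · intro i hi; simp [residual, hi]
  · intro hDc q hq
    simp [residual, hq, running, runningFst, hDc, add_comm]
  · intro i hi hiA
    by_cases hia : i = a
    · subst hia; simp [residual, hiA]
    · simp [residual, hi, hiA, hia, running, add_comm]
  · intro i hi
    have hia : i ≠ a := fun h => hi (h ▸ ha1)
    simp [residual, hi, hia, running, mt (@hA i) hi]

lemma ae_pi_expMeasure_nonneg {ι : Type*} [Fintype ι] (r : ι → ℝ) (hr : ∀ i, 0 < r i) :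
    ∀ᵐ x ∂Measure.pi (fun i => expMeasure (r i)), ∀ i, 0 ≤ x i := by
  have hp : ∀ i, IsProbabilityMeasure (expMeasure (r i)) :=
    fun i => isProbabilityMeasure_expMeasure (hr i)
  rw [ae_all_iff]
  exact fun i => (Measure.quasiMeasurePreserving_eval (fun i => expMeasure (r i)) i).ae
    (ae_nonneg_expMeasure (r i))

/-- A clock `i` of the race `J` wins, at an exponential time, with probability `r i / ∑ j ∈ J, r j`,
and the remaining expectation is then `c`. -/
lemma lintegral_race_summand {ι : Type*} [Fintype ι] [DecidableEq ι] (r : ι → ℝ)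
    (hr : ∀ i, 0 < r i) {J : Finset ι} {i : ι} (hi : i ∈ J) {f : (ι → ℝ) → ℝ}
    {g : (ι → ℝ) → ℝ} (hg : ∀ x, (∀ j, 0 ≤ x j) → 0 ≤ g x)
    (hfg : ∀ s x, 0 ≤ s → (∀ j, 0 ≤ x j) →
      f (Function.update (fun j => if j ∈ J then x j + s else x j) i s) = s + g x) {c : ℝ}
    (hc : 0 ≤ c) (hgc : ∫⁻ x, ENNReal.ofReal (g x) ∂Measure.pi (fun i => expMeasure (r i)) =
      ENNReal.ofReal c) :
    ∫⁻ s, ENNReal.ofReal (Real.exp (-((∑ j ∈ J.erase i, r j) * s))) *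
        ∫⁻ x, ENNReal.ofReal (f (Function.update (fun j => if j ∈ J then x j + s else x j) i s))
          ∂Measure.pi (fun i => expMeasure (r i)) ∂expMeasure (r i) =
      ENNReal.ofReal (r i / (∑ j ∈ J, r j) * (1 / (∑ j ∈ J, r j) + c)) := by
  have hp : ∀ i, IsProbabilityMeasure (expMeasure (r i)) :=
    fun i => isProbabilityMeasure_expMeasure (hr i)
  have hsum : ∑ j ∈ J.erase i, r j + r i = ∑ j ∈ J, r j := Finset.sum_erase_add _ _ hi
  have hΛ : 0 < ∑ j ∈ J, r j := Finset.sum_pos (fun j _ => hr j) ⟨i, hi⟩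
  have hpΛ : IsProbabilityMeasure (expMeasure (∑ j ∈ J, r j)) := isProbabilityMeasure_expMeasure hΛ
  have hinner : ∀ᵐ s ∂expMeasure (r i), ENNReal.ofReal (Real.exp (-((∑ j ∈ J.erase i, r j) * s))) *
        ∫⁻ x, ENNReal.ofReal (f (Function.update (fun j => if j ∈ J then x j + s else x j) i s))
          ∂Measure.pi (fun i => expMeasure (r i)) =
      ENNReal.ofReal (Real.exp (-((∑ j ∈ J.erase i, r j) * s))) *
        (ENNReal.ofReal s + ENNReal.ofReal c) := by
    filter_upwards [ae_nonneg_expMeasure (r i)] with s hs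
    congr 1
    rw [← hgc]
    calc _ = ∫⁻ x, (ENNReal.ofReal s + ENNReal.ofReal (g x))
          ∂Measure.pi (fun i => expMeasure (r i)) := by
          refine lintegral_congr_ae ?_
          filter_upwards [ae_pi_expMeasure_nonneg r hr] with x hx
          rw [hfg s x hs hx, ENNReal.ofReal_add hs (hg x hx)]
      _ = _ := by
          rw [lintegral_add_left measurable_const, lintegral_const, measure_univ, mul_one]
  rw [lintegral_congr_ae hinner, lintegral_exp_mul_expMeasure (hr i)
    (Finset.sum_nonneg fun j _ => (hr j).le) (by fun_prop), hsum,
    lintegral_add_right _ measurable_const, lintegral_ofReal_expMeasure hΛ, lintegral_const,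
    measure_univ, mul_one, ← ENNReal.ofReal_add (by positivity) hc, ← ENNReal.ofReal_mul]
  have := hr i
  positivity

/-- When the clocks in `D` and `A` have rung, the expected residual latency is `expectedTime`. -/
theorem lintegral_latency_residual (hk₁ : 1 ≤ k₁) (hkn₁ : k₁ ≤ n₁) (hk₂ : 1 ≤ k₂) (hkn₂ : k₂ ≤ n₂)
    (hμ₁ : 0 < μ₁) (hμ₂ : 0 < μ₂) (N : ℕ) (D : Finset (Fin n₂ × Fin n₁)) (A : Finset (Fin n₂))
    (hD : D.card ≤ n₂ * k₁) (hA : A ⊆ started n₂ k₁ D.card)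
    (hN : n₂ * k₁ - D.card + (k₂ - A.card) = N) :
    ∫⁻ x, ENNReal.ofReal (latency k₁ k₂ (residual D A x))
        ∂Measure.pi (fun i => expMeasure (clockRate μ₁ μ₂ i)) =
      ENNReal.ofReal (expectedTime n₁ n₂ k₁ k₂ μ₁ μ₂ N D.card A.card) := by
  have hr : ∀ i : Clock n₁ n₂, 0 < clockRate μ₁ μ₂ i := by
    rintro (p | i) <;> simpa [clockRate]
  -- Covers every state with `k₂` completed groups, for any `N`. This includes `N = 0`, which forces
  -- `k₂ ≤ A.card`.
  have hzero : ∀ (N : ℕ) (D : Finset (Fin n₂ × Fin n₁)) (A : Finset (Fin n₂)),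
      A ⊆ started n₂ k₁ D.card → k₂ ≤ A.card →
      ∫⁻ x, ENNReal.ofReal (latency k₁ k₂ (residual D A x))
          ∂Measure.pi (fun i => expMeasure (clockRate μ₁ μ₂ i)) =
        ENNReal.ofReal (expectedTime n₁ n₂ k₁ k₂ μ₁ μ₂ N D.card A.card) := by
    intro N D A hA hA₂
    rw [expectedTime_of_ge _ _ hA₂, ENNReal.ofReal_zero]
    refine lintegral_eq_zero_of_ae_eq_zero ?_
    filter_upwards [ae_pi_expMeasure_nonneg _ hr] with x hx
    rw [latency_eq_zero hk₁ hkn₁ hk₂ hA hA₂ (residual_nonneg _ _ hx)]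
    · simp
    · intro q hq; simp [residual, hq]
    · intro i hi; simp [residual, hi]
  induction N generalizing D A with
  | zero => exact hzero _ _ _ hA (by omega)
  | succ N ih =>
    rcases le_or_gt k₂ A.card with hA₂ | hA₂
    · exact hzero _ _ _ hA hA₂
    have hnn : ∀ u v, 0 ≤ expectedTime n₁ n₂ k₁ k₂ μ₁ μ₂ N u v := expectedTime_nonneg hμ₁ hμ₂ N
    have hlat : ∀ D A (x : Clock n₁ n₂ → ℝ), (∀ j, 0 ≤ x j) → 0 ≤ latency k₁ k₂ (residual D A x) :=
      fun D A x hx => latency_nonneg hk₁ hkn₁ hk₂ hkn₂ (residual_nonneg _ _ hx)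
    have hJ := running_nonempty hk₁ hkn₁ hkn₂ hD hA hA₂
    have hsum := sum_running (n₁ := n₁) (μ₁ := μ₁) (μ₂ := μ₂) hk₁ hD hA
    have hΛ := Finset.sum_pos (fun j _ => hr j) hJ
    refine (lintegral_pi_expMeasure_race _ hr hJ ((measurable_latency hk₁ hkn₁ hk₂ hkn₂).comp
      (measurable_residual D A)).ennreal_ofReal).trans ?_
    have hfst : ∀ p ∈ runningFst k₁ D, _ = _ := fun p hp =>
      lintegral_race_summand (clockRate μ₁ μ₂) hr (J := running k₁ D A) (i := Sum.inl p)
        (Finset.inl_mem_disjSum.2 hp) (f := fun x => latency k₁ k₂ (residual D A x))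
        (hlat (insert p D) A)
        (fun s x hs hx => latency_residual_of_fst hk₁ hkn₁ hkn₂ hA hA₂ hs hx hp)
        (hnn (D.card + 1) A.card) (by
          have hDc : D.card < n₂ * k₁ := by
            by_contra h
            simp [runningFst, h] at hp
          have hpD : p ∉ D := by simpa [runningFst, hDc] using hp
          have hcard := Finset.card_insert_of_notMem hpD
          rw [← hcard]
          exact ih _ _ (by omega) (hA.trans (started_mono (by omega))) (by omega))
    have hsnd : ∀ a ∈ started n₂ k₁ D.card \ A, _ = _ := fun a ha =>
      lintegral_race_summand (clockRate μ₁ μ₂) hr (J := running k₁ D A) (i := Sum.inr a)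
        (Finset.inr_mem_disjSum.2 ha) (f := fun x => latency k₁ k₂ (residual D A x))
        (hlat D (insert a A))
        (fun s x hs hx => latency_residual_of_snd hk₁ hkn₁ hkn₂ hA hA₂ hs hx ha)
        (hnn D.card (A.card + 1)) (by
          obtain ⟨ha1, ha2⟩ := Finset.mem_sdiff.1 ha
          have hcard := Finset.card_insert_of_notMem ha2
          rw [← hcard]
          exact ih _ _ hD (Finset.insert_subset ha1 hA) (by omega))
    refine (Finset.sum_disjSum _ _ _).trans ?_
    refine (congrArg₂ (· + ·) (Finset.sum_congr rfl hfst) (Finset.sum_congr rfl hsnd)).trans ?_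
    -- All winners of the same stage contribute equally, so each sum becomes a cardinality times a
    -- rate, that is `rateFst` or `rateSnd`.
    simp only [clockRate, Sum.elim_inl, Sum.elim_inr, Finset.sum_const, nsmul_eq_mul]
    change (∑ i ∈ running k₁ D A, Sum.elim (fun _ => μ₁) (fun _ => μ₂) i) = _ at hsum
    change 0 < (∑ i ∈ running k₁ D A, Sum.elim (fun _ => μ₁) (fun _ => μ₂) i) at hΛ
    rw [hsum] at hΛ ⊢
    have h1 := hnn (D.card + 1) A.card
    have h2 := hnn D.card (A.card + 1)
    rw [← ENNReal.ofReal_natCast, ← ENNReal.ofReal_natCast, ← ENNReal.ofReal_mul (by positivity),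
      ← ENNReal.ofReal_mul (by positivity), ← ENNReal.ofReal_add (by positivity) (by positivity),
      expectedTime, if_pos hA₂]
    congr 1
    rw [← mul_assoc, ← mul_div_assoc, card_runningFst_mul, ← mul_assoc, ← mul_div_assoc,
      card_started_sdiff_mul hk₁ hD hA]
    field_simp
    ring

end ExpectedLatency

/-! ### Generators from jump rates -/

section Generator

variable {S : Type*} [Fintype S] [DecidableEq S]

lemma generator_apply_of_ne (r : S → S → ℝ) {x y : S} (h : x ≠ y) : generator r x y = r x y := by
  simp [generator, h]

lemma isClosedClass_generator {r : S → S → ℝ} {B : Set S}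
    (h : ∀ x ∈ B, ∀ y, r x y ≠ 0 → y ∈ B) : IsClosedClass (generator r) B := by
  intro x hx y hy
  have hxy : x ≠ y := fun hxy => hy (hxy ▸ hx)
  rw [generator_apply_of_ne r hxy]
  by_contra hne
  exact hy (h x hx y hne)

/-- The value `r x x` is irrelevant: it does not enter `generator`, and on the right its factor is
zero. -/
lemma sum_generator_mul (r : S → S → ℝ) (h : S → ℝ) (x : S) :
    ∑ y, generator r x y * h y = ∑ y, r x y * (h y - h x) := by
  rw [← Finset.add_sum_erase _ _ (Finset.mem_univ x),
    ← Finset.add_sum_erase _ (fun y => r x y * (h y - h x)) (Finset.mem_univ x)]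
  have h1 : generator r x x = -∑ z ∈ Finset.univ.erase x, r x z := by simp [generator]
  have h2 : ∑ y ∈ Finset.univ.erase x, generator r x y * h y =
      ∑ y ∈ Finset.univ.erase x, r x y * h y :=
    Finset.sum_congr rfl fun y hy => by
      rw [generator_apply_of_ne r (Finset.ne_of_mem_erase hy).symm]
  simp_rw [h1, h2, mul_sub, Finset.sum_sub_distrib, neg_mul, Finset.sum_mul]
  ring

end Generator

/-! ### The auxiliary chain -/

section AuxiliaryChain

variable {n₁ n₂ k₁ k₂ : ℕ} {μ₁ μ₂ : ℝ}

/-- The states that the chain can reach from `(0, 0)`. -/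
def reachable (n₂ k₁ k₂ : ℕ) : Set (State n₂ k₁ k₂) := {s | (s.2 : ℕ) * k₁ ≤ (s.1 : ℕ)}

lemma isClosedClass_reachable (hk₁ : 1 ≤ k₁) :
    IsClosedClass (generator (rate n₁ n₂ k₁ k₂ μ₁ μ₂)) (reachable n₂ k₁ k₂) := by
  refine isClosedClass_generator fun x hx y hxy => ?_
  simp only [rate] at hxy
  simp only [reachable, Set.mem_ofPred_eq] at hx ⊢
  split_ifs at hxy with h1 h2
  · rw [h1.1, h1.2.1]; omega
  · rw [h2.1, h2.2.1]
    exact (Nat.le_div_iff_mul_le hk₁).1 (h2.2.2.trans_le (min_le_left _ _))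
  · exact absurd rfl hxy

lemma isClosedClass_target :
    IsClosedClass (generator (rate n₁ n₂ k₁ k₂ μ₁ μ₂)) (target n₂ k₁ k₂) := by
  refine isClosedClass_generator fun x hx y hxy => ?_
  simp only [rate] at hxy
  simp only [target, Set.mem_ofPred_eq] at hx ⊢
  split_ifs at hxy with h1 h2
  · omega
  · have := h2.2.2.trans_le (min_le_right _ _)
    omega
  · exact absurd rfl hxy

/-- On reachable states the guards of `rate` are redundant: `y` lies in the state space, which
bounds both coordinates, and `rateSnd` is zero when `v = u / k₁`. Reachability also makes the
truncated subtractions exact. -/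
lemma rate_eq (hkn₁ : k₁ ≤ n₁) (hk₁ : 1 ≤ k₁) {x : State n₂ k₁ k₂} (hx : x ∈ reachable n₂ k₁ k₂)
    (y : State n₂ k₁ k₂) :
    rate n₁ n₂ k₁ k₂ μ₁ μ₂ x y =
      (if (y.1 : ℕ) = x.1 + 1 ∧ (y.2 : ℕ) = x.2 then rateFst n₁ n₂ k₁ μ₁ x.1 else 0) +
      (if (y.1 : ℕ) = x.1 ∧ (y.2 : ℕ) = x.2 + 1 then rateSnd k₁ μ₂ x.1 x.2 else 0) := by
  have hx' : (x.2 : ℕ) * k₁ ≤ x.1 := hx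
  have hv : (x.2 : ℕ) ≤ x.1 / k₁ := (Nat.le_div_iff_mul_le hk₁).2 hx'
  have hy1 : (y.1 : ℕ) < n₂ * k₁ + 1 := y.1.2
  have hy2 : (y.2 : ℕ) < k₂ + 1 := y.2.2
  have hnk : n₂ * k₁ ≤ n₁ * n₂ := by
    rw [mul_comm n₁]; exact Nat.mul_le_mul_left _ hkn₁
  simp only [rate]
  by_cases h1 : (y.1 : ℕ) = x.1 + 1 ∧ (y.2 : ℕ) = x.2
  · have h2 : ¬ ((y.1 : ℕ) = x.1 ∧ (y.2 : ℕ) = x.2 + 1) := by omega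
    have h3 : (x.1 : ℕ) < n₂ * k₁ := by omega
    rw [if_pos ⟨h1.1, h1.2, hx', h3⟩, if_pos h1, if_neg h2, add_zero, rateFst, if_pos h3,
      Nat.cast_sub (by omega)]
    push_cast
    ring
  · rw [if_neg (fun h => h1 ⟨h.1, h.2.1⟩), if_neg h1, zero_add]
    by_cases h2 : (y.1 : ℕ) = x.1 ∧ (y.2 : ℕ) = x.2 + 1
    · rw [if_pos h2, rateSnd, Nat.cast_sub hv]
      by_cases h3 : (x.2 : ℕ) < x.1 / k₁
      · rw [if_pos ⟨h2.1, h2.2, lt_min h3 (by omega)⟩]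
      · rw [if_neg (fun h => h3 (h.2.2.trans_le (min_le_left _ _))), le_antisymm hv (not_lt.1 h3)]
        simp
    · rw [if_neg (fun h => h2 ⟨h.1, h.2.1⟩), if_neg h2]

/-- The bound on `a` is conditional because the jump to `u + 1` leaves the state space at `u = n₂ *
k₁`, where its rate is zero. -/
lemma sum_state_ite_eq {c : ℝ} {f : ℕ → ℕ → ℝ} {a b : ℕ} (hb : b ≤ k₂) (ha : c ≠ 0 → a ≤ n₂ * k₁) :
    ∑ y : State n₂ k₁ k₂, (if (y.1 : ℕ) = a ∧ (y.2 : ℕ) = b then c else 0) * f y.1 y.2 =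
      c * f a b := by
  by_cases hc : c = 0
  · simp [hc]
  have ha' := ha hc
  rw [Finset.sum_eq_single
    ((⟨a, Nat.lt_succ_of_le ha'⟩, ⟨b, Nat.lt_succ_of_le hb⟩) : State n₂ k₁ k₂)]
  · simp
  · intro y _ hy
    rw [if_neg, zero_mul]
    rintro ⟨h1, h2⟩
    exact hy (Prod.ext (Fin.ext h1) (Fin.ext h2))
  · simp

/-- `expectedTime` with the exact number of remaining steps. -/
def hitMean (n₁ n₂ k₁ k₂ : ℕ) (μ₁ μ₂ : ℝ) (u v : ℕ) : ℝ :=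
  expectedTime n₁ n₂ k₁ k₂ μ₁ μ₂ (n₂ * k₁ - u + (k₂ - v)) u v

lemma rateFst_add_rateSnd_pos (hk₁ : 1 ≤ k₁) (hkn₁ : k₁ ≤ n₁) (hkn₂ : k₂ ≤ n₂) (hμ₁ : 0 < μ₁)
    (hμ₂ : 0 < μ₂) {u v : ℕ} (hu : u ≤ n₂ * k₁) (hv : v < k₂) :
    0 < rateFst n₁ n₂ k₁ μ₁ u + rateSnd k₁ μ₂ u v := by
  have hnk : n₂ * k₁ ≤ n₁ * n₂ := by
    rw [mul_comm n₁]; exact Nat.mul_le_mul_left _ hkn₁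
  rcases hu.lt_or_eq with h | h
  · refine add_pos_of_pos_of_nonneg ?_ (rateSnd_nonneg hμ₂ u v)
    rw [rateFst, if_pos h]
    have : 0 < n₁ * n₂ - u := by omega
    positivity
  · refine add_pos_of_nonneg_of_pos (rateFst_nonneg hμ₁ u) ?_
    rw [rateSnd, h, Nat.mul_div_cancel _ hk₁]
    have : 0 < n₂ - v := by omega
    positivity

lemma hitMean_step {u v : ℕ} (hu : u ≤ n₂ * k₁) (hv : v < k₂)
    (hpos : 0 < rateFst n₁ n₂ k₁ μ₁ u + rateSnd k₁ μ₂ u v) :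
    rateFst n₁ n₂ k₁ μ₁ u * (hitMean n₁ n₂ k₁ k₂ μ₁ μ₂ (u + 1) v - hitMean n₁ n₂ k₁ k₂ μ₁ μ₂ u v) +
      rateSnd k₁ μ₂ u v * (hitMean n₁ n₂ k₁ k₂ μ₁ μ₂ u (v + 1) - hitMean n₁ n₂ k₁ k₂ μ₁ μ₂ u v) =
      -1 := by
  obtain ⟨N, hN⟩ : ∃ N, n₂ * k₁ - u + (k₂ - v) = N + 1 := ⟨n₂ * k₁ - u + (k₂ - v) - 1, by omega⟩
  have h1 : rateFst n₁ n₂ k₁ μ₁ u * hitMean n₁ n₂ k₁ k₂ μ₁ μ₂ (u + 1) v =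
      rateFst n₁ n₂ k₁ μ₁ u * expectedTime n₁ n₂ k₁ k₂ μ₁ μ₂ N (u + 1) v := by
    -- At `u = n₂ * k₁` the step counts differ by truncation, but both sides carry the factor
    -- `rateFst = 0`.
    rcases hu.lt_or_eq with h | h
    · rw [hitMean, show n₂ * k₁ - (u + 1) + (k₂ - v) = N by omega]
    · simp [rateFst, h]
  have h2 : hitMean n₁ n₂ k₁ k₂ μ₁ μ₂ u (v + 1) =
      expectedTime n₁ n₂ k₁ k₂ μ₁ μ₂ N u (v + 1) := by
    rw [hitMean, show n₂ * k₁ - u + (k₂ - (v + 1)) = N by omega]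
  have h3 : hitMean n₁ n₂ k₁ k₂ μ₁ μ₂ u v =
      (1 + rateFst n₁ n₂ k₁ μ₁ u * hitMean n₁ n₂ k₁ k₂ μ₁ μ₂ (u + 1) v +
        rateSnd k₁ μ₂ u v * hitMean n₁ n₂ k₁ k₂ μ₁ μ₂ u (v + 1)) /
        (rateFst n₁ n₂ k₁ μ₁ u + rateSnd k₁ μ₂ u v) := by
    rw [h1, h2, hitMean, hN, expectedTime, if_pos hv]
  rw [eq_div_iff hpos.ne'] at h3
  linarith

lemma sum_generator_mul_hitMean (hk₁ : 1 ≤ k₁) (hkn₁ : k₁ ≤ n₁) (hkn₂ : k₂ ≤ n₂) (hμ₁ : 0 < μ₁)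
    (hμ₂ : 0 < μ₂) {x : State n₂ k₁ k₂} (hx : x ∈ reachable n₂ k₁ k₂) (hxt : x ∉ target n₂ k₁ k₂) :
    ∑ y, generator (rate n₁ n₂ k₁ k₂ μ₁ μ₂) x y * hitMean n₁ n₂ k₁ k₂ μ₁ μ₂ y.1 y.2 = -1 := by
  have hx' : (x.2 : ℕ) * k₁ ≤ x.1 := hx
  have hu : (x.1 : ℕ) ≤ n₂ * k₁ := Nat.le_of_lt_succ x.1.2
  have hv : (x.2 : ℕ) < k₂ := by
    refine lt_of_le_of_ne (Nat.le_of_lt_succ x.2.2) fun h => hxt ⟨h, ?_⟩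
    rwa [h] at hx'
  rw [sum_generator_mul _ (fun y : State n₂ k₁ k₂ => hitMean n₁ n₂ k₁ k₂ μ₁ μ₂ y.1 y.2)]
  simp_rw [rate_eq hkn₁ hk₁ hx, add_mul]
  rw [Finset.sum_add_distrib,
    sum_state_ite_eq (f := fun u v => hitMean n₁ n₂ k₁ k₂ μ₁ μ₂ u v -
      hitMean n₁ n₂ k₁ k₂ μ₁ μ₂ x.1 x.2) hv.le (fun h => ?_),
    sum_state_ite_eq (f := fun u v => hitMean n₁ n₂ k₁ k₂ μ₁ μ₂ u v -
      hitMean n₁ n₂ k₁ k₂ μ₁ μ₂ x.1 x.2) hv fun _ => hu]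
  · exact hitMean_step hu hv (rateFst_add_rateSnd_pos hk₁ hkn₁ hkn₂ hμ₁ hμ₂ hu hv)
  · by_contra hlt
    exact h (by rw [rateFst, if_neg (by omega)])

theorem lintegral_hittingTime_target (hk₁ : 1 ≤ k₁) (hkn₁ : k₁ ≤ n₁) (hkn₂ : k₂ ≤ n₂)
    (hμ₁ : 0 < μ₁) (hμ₂ : 0 < μ₂) {Ω : Type*} [MeasurableSpace Ω] {P : Measure Ω}
    [IsProbabilityMeasure P] {X : ℝ≥0 → Ω → State n₂ k₁ k₂}
    (hX : IsContinuousTimeMarkovChain (generator (rate n₁ n₂ k₁ k₂ μ₁ μ₂)) (0, 0) X P) :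
    ∫⁻ ω, hittingTime X (target n₂ k₁ k₂) ω ∂P =
      ENNReal.ofReal (hitMean n₁ n₂ k₁ k₂ μ₁ μ₂ 0 0) :=
  hX.lintegral_hittingTime (B := reachable n₂ k₁ k₂)
    (h := fun x => hitMean n₁ n₂ k₁ k₂ μ₁ μ₂ x.1 x.2) isClosedClass_target
    (isClosedClass_reachable hk₁) (by simp [reachable])
    (fun _ => expectedTime_nonneg hμ₁ hμ₂ _ _ _) (fun _ hx => expectedTime_of_ge _ _ hx.1.ge)
    fun _ hx hxt => sum_generator_mul_hitMean hk₁ hkn₁ hkn₂ hμ₁ hμ₂ hx hxt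

end AuxiliaryChain

/-! ### Joint law of the clocks -/

section Law

variable {n₁ n₂ k₁ k₂ : ℕ} {μ₁ μ₂ : ℝ}

lemma lowerBoundTime_eq_latency {Ω : Type*} (T : Fin n₂ → Fin n₁ → Ω → ℝ) (Tc : Fin n₂ → Ω → ℝ) :
    lowerBoundTime k₁ k₂ T Tc = fun ω => latency k₁ k₂ fun i : Clock n₁ n₂ =>
      (Sum.elim (fun p : Fin n₂ × Fin n₁ => T p.1 p.2) Tc : Clock n₁ n₂ → Ω → ℝ) i ω := rfl

lemma hasLaw_clocks {Ω : Type*} [MeasurableSpace Ω] {ν : Measure Ω}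
    [IsProbabilityMeasure ν] {T : Fin n₂ → Fin n₁ → Ω → ℝ} {Tc : Fin n₂ → Ω → ℝ}
    (hT : ∀ i j, HasLaw (T i j) (expMeasure μ₁) ν) (hTc : ∀ i, HasLaw (Tc i) (expMeasure μ₂) ν)
    (hindep : iIndepFun
      (Sum.elim (fun p : Fin n₂ × Fin n₁ => T p.1 p.2) Tc : (Fin n₂ × Fin n₁) ⊕ Fin n₂ → Ω → ℝ) ν) :
    HasLaw (fun ω (i : Clock n₁ n₂) =>
        (Sum.elim (fun p : Fin n₂ × Fin n₁ => T p.1 p.2) Tc : Clock n₁ n₂ → Ω → ℝ) i ω)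
      (Measure.pi fun i => expMeasure (clockRate μ₁ μ₂ i)) ν := by
  have hlaw : ∀ i : Clock n₁ n₂,
      HasLaw ((Sum.elim (fun p : Fin n₂ × Fin n₁ => T p.1 p.2) Tc : Clock n₁ n₂ → Ω → ℝ) i)
        (expMeasure (clockRate μ₁ μ₂ i)) ν := by
    rintro (p | i)
    · exact hT p.1 p.2
    · exact hTc i
  refine ⟨aemeasurable_pi_lambda _ fun i => (hlaw i).aemeasurable, ?_⟩
  rw [(iIndepFun_iff_map_fun_eq_pi_map fun i => (hlaw i).aemeasurable).1 hindep]
  simp_rw [fun i => (hlaw i).map_eq]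

end Law

end HierCoding

end

open HierCoding in
theorem lemma1 (n₁ n₂ k₁ k₂ : ℕ) (hk₁ : 1 ≤ k₁) (hkn₁ : k₁ ≤ n₁) (hk₂ : 1 ≤ k₂) (hkn₂ : k₂ ≤ n₂)
    (μ₁ μ₂ : ℝ) (hμ₁ : 0 < μ₁) (hμ₂ : 0 < μ₂)
    -- the latencies: mutually independent, exponential with rates `μ₁` and `μ₂`
    {Ω : Type*} [MeasurableSpace Ω] (ν : Measure Ω) [IsProbabilityMeasure ν]
    (T : Fin n₂ → Fin n₁ → Ω → ℝ) (Tc : Fin n₂ → Ω → ℝ)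
    (hT : ∀ i j, HasLaw (T i j) (expMeasure μ₁) ν)
    (hTc : ∀ i, HasLaw (Tc i) (expMeasure μ₂) ν)
    (hindep : iIndepFun
      (Sum.elim (fun p : Fin n₂ × Fin n₁ => T p.1 p.2) Tc : (Fin n₂ × Fin n₁) ⊕ Fin n₂ → Ω → ℝ) ν)
    -- the auxiliary chain, started at `(0, 0)`
    {Ω' : Type*} [MeasurableSpace Ω'] (P : Measure Ω') [IsProbabilityMeasure P]
    (X : ℝ≥0 → Ω' → HierCoding.State n₂ k₁ k₂)
    (hX : HierCoding.IsContinuousTimeMarkovChain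
      (HierCoding.generator (HierCoding.rate n₁ n₂ k₁ k₂ μ₁ μ₂)) (0, 0) X P) :
    Integrable (HierCoding.lowerBoundTime k₁ k₂ T Tc) ν ∧
    AEMeasurable (HierCoding.hittingTime X (HierCoding.target n₂ k₁ k₂)) P ∧
    ∫⁻ ω, HierCoding.hittingTime X (HierCoding.target n₂ k₁ k₂) ω ∂P =
      ENNReal.ofReal (∫ ω, HierCoding.lowerBoundTime k₁ k₂ T Tc ω ∂ν) := by
  have hr : ∀ i : Clock n₁ n₂, 0 < clockRate μ₁ μ₂ i := by
    rintro (p | i) <;> simpa [clockRate]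
  have hlaw := hasLaw_clocks hT hTc hindep
  have hmeas := measurable_latency hk₁ hkn₁ hk₂ hkn₂
  have haem : AEMeasurable (lowerBoundTime k₁ k₂ T Tc) ν := by
    rw [lowerBoundTime_eq_latency]
    exact hmeas.comp_aemeasurable hlaw.aemeasurable
  have hnonneg : 0 ≤ᵐ[ν] lowerBoundTime k₁ k₂ T Tc := by
    have h := ae_pi_expMeasure_nonneg _ hr
    rw [← hlaw.map_eq] at h
    filter_upwards [ae_of_ae_map hlaw.aemeasurable h] with ω hω
    rw [lowerBoundTime_eq_latency]
    exact latency_nonneg hk₁ hkn₁ hk₂ hkn₂ hω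
  have hlint : ∫⁻ ω, ENNReal.ofReal (lowerBoundTime k₁ k₂ T Tc ω) ∂ν =
      ENNReal.ofReal (hitMean n₁ n₂ k₁ k₂ μ₁ μ₂ 0 0) := by
    -- Initially no clock has rung, and the number of remaining steps is the one used in `hitMean`
    -- at `(0, 0)`.
    have h := lintegral_latency_residual hk₁ hkn₁ hk₂ hkn₂ hμ₁ hμ₂ _ ∅ ∅ (Nat.zero_le _)
      (Finset.empty_subset _) rfl
    simp_rw [residual_empty] at h
    rw [← hlaw.map_eq, lintegral_map' hmeas.ennreal_ofReal.aemeasurable hlaw.aemeasurable] at h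
    rw [lowerBoundTime_eq_latency]
    exact h
  have hint : Integrable (lowerBoundTime k₁ k₂ T Tc) ν :=
    (lintegral_ofReal_ne_top_iff_integrable haem.aestronglyMeasurable hnonneg).1
      (hlint ▸ ENNReal.ofReal_ne_top)
  refine ⟨hint, (measurable_hittingTime (fun t => hX.measurableSet_mem t _)
    hX.rightContinuous).aemeasurable, ?_⟩
  rw [ofReal_integral_eq_lintegral_ofReal hint hnonneg, hlint]
  exact lintegral_hittingTime_target hk₁ hkn₁ hkn₂ hμ₁ hμ₂ hX
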